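/- A (non-empty) \emph{non-ambiguous tree} (NAT) $T$ is a non-empty binary tree (every vertex has at most one left child and at most one right child) whose $\ell$ left children are labelled bijectively by $1,\dots,\ell$ and whose $r$ right children are labelled bijectively by $1,\dots,r$, such that if $U\neq V$ are both left children (or both right children) and $U$ is an ancestor of $V$, then the label of $U$ is strictly greater than that of $V$. Its geometric size is $\mathrm{w}_L(T)\times \mathrm{w}_R(T)$ with $\mathrm{w}_L(T)=\ell+1$ and $\mathrm{w}_R(T)=r+1$. The leftmost (resp. rightmost) branch starting at a vertex $v$ consists of $v$ and the vertices reached from $v$ by going only to left (resp. right) children. Let $\mathrm{lo}(T)$ (resp. $\mathrm{ro}(T)$) be the number of non-root vertices in the leftmost (resp. rightmost) branch starting at the root. The hook of a vertex $v$ is the union of the leftmost and rightmost branches starting at $v$; the vertices of $T$ can be partitioned into hooks in exactly one way, and $\mathrm{hook}(T)$ is the number of hooks in this partition. Let $S_{2,q}(n,k)$ be the sum, over all partitions of $\{1,\dots,n\}$ into $k$ non-empty parts, of $q^{m}$, where $m$ is the number of elements different from $n$ in the part containing $n$. Let $(t)_{n}=t(t+1)\cdots(t+n-1)$ denote the rising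 factorial, with $(t)_0=1$. Theorem. Let $\alpha,\beta$ be indeterminates (or, more generally, elements of any commutative $\mathbb{Q}$-algebra). For all positive integers $i,j,p$, \[ \sum_{T}\alpha^{\mathrm{lo}(T)}\beta^{\mathrm{ro}(T)}=(p-1)!\,(\alpha+\beta)_{p-1}\,S_{2,\alpha}(i,p)\,S_{2,\beta}(j,p), \] where the sum is over all non-ambiguous trees $T$ of geometric size $i\times j$ with $\mathrm{hook}(T)=p$. Moreover, as formal power series in $x,y,z$, \[ \sum_{T}\alpha^{\mathrm{lo}(T)}\beta^{\mathrm{ro}(T)}z^{\mathrm{hook}(T)}\frac{x^{\mathrm{w}_L(T)-1}\,y^{\mathrm{w}_R(T)-1}}{(\mathrm{w}_L(T)-1)!\,(\mathrm{w}_R(T)-1)!} =\frac{z\,e^{\alpha x+\beta y}}{\bigl(1-z(e^x-1)(e^y-1)\bigr)^{\alpha+\beta}}, \] where the sum is over all non-empty non-ambiguous trees $T$, and $(1+u)^{r}=\sum_{n\ge 0}\frac{r(r-1)\cdots(r-n+1)}{n!}u^n$ for a series $u$ with zero constant term. -/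

import Mathlib

open scoped Nat
open Finset

/-! ### Binary trees

Binary trees (unlabelled, each child being a left or a right child) are `BinaryTree Unit`.
A vertex is represented by its address: the list of steps from the root to the vertex,
a step to a left child being `false` and a step to a right child being `true`.
The root is `[]`. -/

namespace BinTree

/-- The vertices of a binary tree, as addresses. -/
def verts : BinaryTree Unit → Finset (List Bool)
  | .nil => ∅
  | .node _ l r =>
      insert [] ((verts l).image (List.cons false) ∪ (verts r).image (List.cons true))

/-- The set of left children (`a = false`), respectively of right children (`a = true`). -/
def childVerts (a : Bool) (B : BinaryTree Unit) : Finset (List Bool) :=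
  {v ∈ verts B | v.getLast? = some a}

open Classical in
/-- The leftmost (`a = false`) or rightmost (`a = true`) branch of the subtree whose root is the
vertex `v`: the vertex `v` and those obtained from it by going only to the left (right). -/
noncomputable def branch (B : BinaryTree Unit) (a : Bool) (v : List Bool) : Finset (List Bool) :=
  {w ∈ verts B | ∃ k : ℕ, w = v ++ List.replicate k a}

/-- The number of non-root vertices in the leftmost (`a = false`), respectively rightmost
(`a = true`), branch of the tree. -/
noncomputable def branchLength (a : Bool) (B : BinaryTree Unit) : ℕ := #((branch B a []).erase [])

/-- The hook of a vertex `v`: the union of `{v}`, its leftmost branch and its rightmost branch. -/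
noncomputable def hook (B : BinaryTree Unit) (v : List Bool) : Finset (List Bool) :=
  branch B false v ∪ branch B true v

/-- The hooks of the vertices in `R` form a partition of the vertex set. -/
def IsHookPartition (B : BinaryTree Unit) (R : Finset (List Bool)) : Prop :=
  R ⊆ verts B ∧ ∀ v ∈ verts B, ∃! r, r ∈ R ∧ v ∈ hook B r

/-- The roots of the hooks in the hook partition of a tree: extract the hook of the root and
iterate on the remaining forest. The first argument `m` tells which part of the hook of the root
has been extracted by an ancestor: with `m = none`, the root is itself the root of a hook; with
`m = some a`, the root and its leftmost (`a = false`) or rightmost (`a = true`) branch belong to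
the hook of an ancestor. -/
def hookRootsAux : Option Bool → BinaryTree Unit → Finset (List Bool)
  | _, .nil => ∅
  | none, .node _ l r =>
      insert [] ((hookRootsAux (some false) l).image (List.cons false) ∪
        (hookRootsAux (some true) r).image (List.cons true))
  | some false, .node _ l r =>
      (hookRootsAux (some false) l).image (List.cons false) ∪
        (hookRootsAux none r).image (List.cons true)
  | some true, .node _ l r =>
      (hookRootsAux none l).image (List.cons false) ∪
        (hookRootsAux (some true) r).image (List.cons true)

/-- The set of roots of the hooks in the hook partition; see `isHookPartition_iff`. -/
def hookRoots (B : BinaryTree Unit) : Finset (List Bool) := hookRootsAux none B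

/-- The hook number: the number of hooks in the unique partition of the vertices into hooks. -/
def hookNumber (B : BinaryTree Unit) : ℕ := #(hookRoots B)

theorem hookRootsAux_subset (B : BinaryTree Unit) :
    ∀ m, hookRootsAux m B ⊆ verts B := by
  induction B with
  | nil => intro m; simp [hookRootsAux]
  | node u l r hl hr =>
    rintro (_ | _ | _) v <;>
      simp only [hookRootsAux, verts, mem_insert, mem_union, mem_image] <;> grind

/-- Membership in a hook, without the condition of being a vertex. -/
def InHook (r v : List Bool) : Prop :=
  ∃ a : Bool, ∃ k : ℕ, v = r ++ List.replicate k a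

theorem mem_hook {B : BinaryTree Unit} {r v : List Bool} :
    v ∈ hook B r ↔ v ∈ verts B ∧ InHook r v := by
  simp only [hook, branch, InHook, mem_union, mem_filter, Bool.exists_bool]
  tauto

theorem inHook_cons {a b : Bool} {r v : List Bool} :
    InHook (a :: r) (b :: v) ↔ a = b ∧ InHook r v := by
  simp only [InHook, List.cons_append, List.cons.injEq]
  grind

theorem not_inHook_nil {a : Bool} {r : List Bool} : ¬ InHook (a :: r) [] := by
  simp [InHook]

theorem inHook_nil_cons {b : Bool} {v : List Bool} :
    InHook [] (b :: v) ↔ ∃ k : ℕ, v = List.replicate k b := by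
  constructor
  · rintro ⟨a, _ | k, h⟩
    · simp at h
    · simp [List.replicate_succ] at h
      exact ⟨k, by rw [h.1]; exact h.2⟩
  · rintro ⟨k, rfl⟩
    exact ⟨b, k + 1, by simp [List.replicate_succ]⟩

theorem existsUnique_cons {b : Bool} {S F : Finset (List Bool)} {w : List Bool}
    (hF : ∀ r, b :: r ∈ F ↔ r ∈ S) (hnil : [] ∈ F → ¬ InHook [] (b :: w))
    (h : ∃! r, r ∈ S ∧ InHook r w) : ∃! r, r ∈ F ∧ InHook r (b :: w) := by
  obtain ⟨r, ⟨hr, hrw⟩, huniq⟩ := h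
  refine ⟨b :: r, ⟨(hF r).2 hr, inHook_cons.2 ⟨rfl, hrw⟩⟩, ?_⟩
  rintro (_ | ⟨c, t⟩) ⟨ht, htw⟩
  · exact absurd htw (hnil ht)
  · obtain ⟨rfl, htw'⟩ := inHook_cons.1 htw
    rw [huniq t ⟨(hF t).1 ht, htw'⟩]

theorem cons_mem_verts {b : Bool} {l r : BinaryTree Unit} {u : Unit} {w : List Bool} :
    b :: w ∈ verts (.node u l r) ↔ w ∈ verts (if b then r else l) := by
  cases b <;> simp [verts]

theorem replicate_cons_iff {a b : Bool} {w : List Bool} :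
    (∃ k : ℕ, b :: w = List.replicate k a) ↔ b = a ∧ ∃ k : ℕ, w = List.replicate k a := by
  constructor
  · rintro ⟨_ | k, h⟩
    · simp at h
    · simp only [List.replicate_succ, List.cons.injEq] at h
      exact ⟨h.1, k, h.2⟩
  · rintro ⟨rfl, k, rfl⟩
    exact ⟨k + 1, by simp [List.replicate_succ]⟩

theorem cons_mem_hookRootsAux_none {b : Bool} {l r : BinaryTree Unit} {u : Unit}
    {w : List Bool} : b :: w ∈ hookRootsAux none (.node u l r) ↔
      w ∈ hookRootsAux (some b) (if b then r else l) := by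
  cases b <;> simp [hookRootsAux]

theorem cons_mem_hookRootsAux_some {a b : Bool} {l r : BinaryTree Unit} {u : Unit}
    {w : List Bool} : b :: w ∈ hookRootsAux (some a) (.node u l r) ↔
      w ∈ hookRootsAux (if b = a then some a else none) (if b then r else l) := by
  cases a <;> cases b <;> simp [hookRootsAux]

theorem nil_notMem_hookRootsAux_some {a : Bool} {B : BinaryTree Unit} :
    [] ∉ hookRootsAux (some a) B := by
  cases B <;> cases a <;> simp [hookRootsAux]

theorem hookRootsAux_spec (B : BinaryTree Unit) :
    (∀ v ∈ verts B, ∃! r, r ∈ hookRootsAux none B ∧ InHook r v) ∧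
    ∀ a : Bool, ∀ v ∈ verts B,
      ((∃ k : ℕ, v = List.replicate k a) → ∀ r ∈ hookRootsAux (some a) B, ¬ InHook r v) ∧
      ((¬ ∃ k : ℕ, v = List.replicate k a) →
        ∃! r, r ∈ hookRootsAux (some a) B ∧ InHook r v) := by
  induction B with
  | nil => simp [verts]
  | node u l r hl hr =>
    have hsub : ∀ b : Bool, ∀ w ∈ verts (if b then r else l),
        (∃! t, t ∈ hookRootsAux none (if b then r else l) ∧ InHook t w) ∧
        ∀ a : Bool,
          ((∃ k : ℕ, w = List.replicate k a) →
            ∀ t ∈ hookRootsAux (some a) (if b then r else l), ¬ InHook t w) ∧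
          ((¬ ∃ k : ℕ, w = List.replicate k a) →
            ∃! t, t ∈ hookRootsAux (some a) (if b then r else l) ∧ InHook t w) := by
      intro b w hw
      cases b
      · exact ⟨hl.1 w hw, fun a => hl.2 a w hw⟩
      · exact ⟨hr.1 w hw, fun a => hr.2 a w hw⟩
    constructor
    · rintro (_ | ⟨b, w⟩) hv
      · refine ⟨[], ⟨by simp [hookRootsAux], false, 0, by simp⟩, ?_⟩
        rintro (_ | ⟨c, t⟩) ⟨-, ht⟩
        · rfl
        · exact absurd ht not_inHook_nil
      · have hw := hsub b w (cons_mem_verts.1 hv)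
        by_cases hrep : ∃ k : ℕ, w = List.replicate k b
        · refine ⟨[], ⟨by simp [hookRootsAux], inHook_nil_cons.2 hrep⟩, ?_⟩
          rintro (_ | ⟨c, t⟩) ⟨hmem, ht⟩
          · rfl
          · obtain ⟨rfl, htw⟩ := inHook_cons.1 ht
            exact absurd htw ((hw.2 c).1 hrep t (cons_mem_hookRootsAux_none.1 hmem))
        · exact existsUnique_cons (fun t => cons_mem_hookRootsAux_none)
            (fun _ h => hrep (inHook_nil_cons.1 h)) ((hw.2 b).2 hrep)
    · rintro a (_ | ⟨b, w⟩) hv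
      · refine ⟨?_, fun h => absurd ⟨0, by simp⟩ h⟩
        rintro - (_ | ⟨c, t⟩) hmem ht
        · exact nil_notMem_hookRootsAux_some hmem
        · exact not_inHook_nil ht
      · have hw := hsub b w (cons_mem_verts.1 hv)
        rw [replicate_cons_iff]
        constructor
        · rintro ⟨rfl, hrep⟩ (_ | ⟨c, t⟩) hmem ht
          · exact nil_notMem_hookRootsAux_some hmem
          · obtain ⟨rfl, htw⟩ := inHook_cons.1 ht
            rw [cons_mem_hookRootsAux_some, if_pos rfl] at hmem
            exact (hw.2 c).1 hrep t hmem htw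
        · intro hrep
          refine existsUnique_cons (fun t => cons_mem_hookRootsAux_some)
            (fun h => absurd h nil_notMem_hookRootsAux_some) ?_
          by_cases hba : b = a
          · rw [if_pos hba]
            exact (hw.2 a).2 fun h => hrep ⟨hba, h⟩
          · rw [if_neg hba]
            exact hw.1

theorem isHookPartition_iff (B : BinaryTree Unit) (R : Finset (List Bool)) :
    IsHookPartition B R ↔ R = hookRoots B := by
  have hex : IsHookPartition B (hookRoots B) := by
    refine ⟨hookRootsAux_subset B none, fun v hv => ?_⟩
    simp only [mem_hook, hv, true_and]
    exact (hookRootsAux_spec B).1 v hv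
  refine ⟨fun hR => ?_, fun h => h ▸ hex⟩
  have key : ∀ n : ℕ, ∀ v : List Bool, v.length = n → (v ∈ R ↔ v ∈ hookRoots B) := by
    intro n
    induction n using Nat.strong_induction_on with
    | _ n ih =>
      have aux : ∀ S T : Finset (List Bool), IsHookPartition B S → IsHookPartition B T →
          (∀ m < n, ∀ v : List Bool, v.length = m → (v ∈ S ↔ v ∈ T)) →
          ∀ v : List Bool, v.length = n → v ∈ S → v ∈ T := by
        intro S T hS hT h v hv hvS
        have hvB := hS.1 hvS
        obtain ⟨r, ⟨hrT, hvr⟩, -⟩ := hT.2 v hvB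
        obtain ⟨-, a, k, hk⟩ := mem_hook.1 hvr
        rcases Nat.eq_zero_or_pos k with rfl | hpos
        · simp at hk; rwa [hk]
        · have hlen : r.length < n := by
            rw [← hv, hk]; simp; omega
          have hrS : r ∈ S := (h _ hlen r rfl).2 hrT
          have := (hS.2 v hvB).unique ⟨hrS, hvr⟩
            ⟨hvS, mem_hook.2 ⟨hvB, false, 0, by simp⟩⟩
          rw [this] at hlen
          omega
      intro v hv
      exact ⟨aux _ _ hR hex ih v hv, aux _ _ hex hR (fun m hm w hw => (ih m hm w hw).symm) v hv⟩
  ext v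
  exact key _ v rfl

theorem card_verts (B : BinaryTree Unit) : #(verts B) = B.numNodes := by
  induction B with
  | nil => simp [verts]
  | node u l r hl hr =>
    rw [verts, card_insert_of_notMem (by simp), card_union_of_disjoint,
      card_image_of_injective _ List.cons_injective, card_image_of_injective _ List.cons_injective,
      hl, hr, BinaryTree.numNodes]
    rw [disjoint_left]
    simp only [mem_image]
    grind

theorem card_childVerts (B : BinaryTree Unit) (hB : B ≠ .nil) :
    #(childVerts false B) + #(childVerts true B) + 1 = B.numNodes := by
  have h0 : [] ∈ verts B := by
    cases B with
    | nil => exact absurd rfl hB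
    | node u l r => simp [verts]
  have hunion : verts B = insert [] (childVerts false B ∪ childVerts true B) := by
    ext v
    rcases v.eq_nil_or_concat with rfl | ⟨t, b, rfl⟩
    · simp [h0]
    · cases b <;> simp [childVerts]
  rw [← card_verts, hunion, card_insert_of_notMem (by simp [childVerts]), card_union_of_disjoint]
  rw [disjoint_left]
  simp only [childVerts, mem_filter]
  grind

end BinTree

open BinTree

/-- A non-empty non-ambiguous tree: a non-empty binary tree whose left (right) children are
labelled bijectively by `1, …, n` where `n` is their number, so that the label of a left (right)
child is strictly greater than the labels of the left (right) children that are proper descendants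
of it. -/
structure NAT where
  shape : BinaryTree Unit
  shape_ne_nil : shape ≠ .nil
  label : (a : Bool) → childVerts a shape ≃ Finset.Icc 1 #(childVerts a shape)
  label_lt : ∀ (a : Bool) (u v : childVerts a shape),
    u.1 <+: v.1 → u ≠ v → (label a v : ℕ) < label a u

namespace NAT

/-- The geometric size of `T` is `wL T × wR T`. -/
def wL (T : NAT) : ℕ := #(childVerts false T.shape) + 1

def wR (T : NAT) : ℕ := #(childVerts true T.shape) + 1

/-- The number of non-root vertices in the leftmost branch. -/
noncomputable def lo (T : NAT) : ℕ := branchLength false T.shape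

/-- The number of non-root vertices in the rightmost branch. -/
noncomputable def ro (T : NAT) : ℕ := branchLength true T.shape

def hookNumber (T : NAT) : ℕ := BinTree.hookNumber T.shape

theorem finite_geometricSize (i j : ℕ) : {T : NAT | T.wL = i ∧ T.wR = j}.Finite := by
  let f : (Σ B : BinaryTree Unit,
      (a : Bool) → childVerts a B ≃ Finset.Icc 1 #(childVerts a B)) → Set NAT :=
    fun x => {T | T.shape = x.1 ∧ HEq T.label x.2}
  have hf : ∀ x, (f x).Finite := by
    intro x
    refine Set.Subsingleton.finite ?_
    rintro ⟨s, h, lab, h'⟩ ⟨h1, h2⟩ ⟨t, k, lab', k'⟩ ⟨h3, h4⟩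
    dsimp only at h1 h2 h3 h4
    subst h1
    subst h3
    have := h2.trans h4.symm
    cases this
    rfl
  have hfin : (⋃ B ∈ (BinaryTree.treesOfNumNodesEq (i + j - 1) : Set (BinaryTree Unit)),
      ⋃ x : ((a : Bool) → childVerts a B ≃ Finset.Icc 1 #(childVerts a B)),
        f ⟨B, x⟩).Finite :=
    (Finset.finite_toSet _).biUnion fun B _ => Set.finite_iUnion fun x => hf _
  refine hfin.subset ?_
  rintro T ⟨h1, h2⟩
  simp only [Set.mem_iUnion]
  refine ⟨T.shape, ?_, T.label, rfl, HEq.rfl⟩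
  have := card_childVerts T.shape T.shape_ne_nil
  simp only [wL, wR] at h1 h2
  simp only [mem_coe, BinaryTree.mem_treesOfNumNodesEq]
  omega

/-- The finite set of non-ambiguous trees of geometric size `i × j`. -/
noncomputable def ofGeometricSize (i j : ℕ) : Finset NAT := (finite_geometricSize i j).toFinset

variable {R : Type*} [CommRing R] [Algebra ℚ R]

/-- The monomial `α^lo(T) β^ro(T) z^hook(T) x^(wL(T)-1) y^(wR(T)-1) / ((wL(T)-1)! (wR(T)-1)!)`,
where `x`, `y`, `z` are the variables `0`, `1`, `2`. -/
noncomputable def weight (α β : R) (T : NAT) : MvPowerSeries (Fin 3) R :=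
  MvPowerSeries.monomial
    (Finsupp.single 0 (T.wL - 1) + Finsupp.single 1 (T.wR - 1) + Finsupp.single 2 T.hookNumber)
    (algebraMap ℚ R (1 / ((T.wL - 1)! * (T.wR - 1)!)) * (α ^ T.lo * β ^ T.ro))

/-- Each coefficient of the formal sum of the weights of all non-empty non-ambiguous trees is a
finite sum. -/
theorem finite_support_coeff_weight (α β : R) (n : Fin 3 →₀ ℕ) :
    (Function.support fun T : NAT => MvPowerSeries.coeff n (T.weight α β)).Finite := by
  refine (finite_geometricSize (n 0 + 1) (n 1 + 1)).subset ?_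
  intro T hT
  rw [Function.mem_support, weight, MvPowerSeries.coeff_monomial] at hT
  have hn := (ite_ne_right_iff.1 hT).1
  subst hn
  simp [wL, wR]

/-- The generating series of non-empty non-ambiguous trees: the formal sum, coefficient by
coefficient, of the weights of all of them. -/
noncomputable def genSeries (α β : R) : MvPowerSeries (Fin 3) R :=
  fun n => ∑ᶠ T : NAT, MvPowerSeries.coeff n (T.weight α β)

end NAT

/-- The `q`-Stirling number of the second kind `S_{2,q}(n,k)`: the sum over the partitions of
`{1, …, n}` into `k` parts of `q` to the number of elements different from `n` in the part that
contains `n`. -/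
noncomputable def qStirling {R : Type*} [CommRing R] (q : R) (n k : ℕ) : R :=
  ∑ P : Finpartition (Finset.Icc 1 n) with #P.parts = k, q ^ #((P.part n).erase n)


/-- The binomial series `(1 + X)^r = ∑ r (r - 1) ⋯ (r - n + 1) / n! X^n`. -/
noncomputable def binomSeries {R : Type*} [CommRing R] [Algebra ℚ R] (r : R) : PowerSeries R :=
  PowerSeries.mk fun n => algebraMap ℚ R (1 / n !) * (descPochhammer R n).eval r

/-! Left labels and right labels are independent, so a shape with ℓ left and r right children
carries ℓ! r! times a product of two probabilities: that a random labelling of the left children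
decreases away from the root, and the same for the right children. The exponential normalisation of
the series therefore leaves, for each shape, a monomial weighted by these two densities
(`card_shape_eq`), and the densities factor along the tree: a product over disjoint subtrees
(`decrDensity_sum`), a division by the number of vertices when a new maximum is put on top
(`decrDensity_option`).

Cut a tree at its root. The left subtree contributes a series P(α), the right one Q(β), and the
root's hook a factor z, so the full series is z P(α) Q(β) (`genSeries_eq`). In a subtree hanging to
the left, the root is a left child with the greatest left label; ∂/∂x cancels the resulting division
and exposes its two subtrees. This gives ∂ₓP(α) = α P(α) J, where J counts right subtrees attached
to a left branch. Their roots start new hooks, so ∂ᵧJ = z P(1) Q(1). The mirror equations hold for Q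
and K (`isHookSystem_treeSum`).

Together with the values P = K = 1 at x = 0 and Q = J = 1 at y = 0, the system determines its
solution degree by degree (`IsHookSystem.unique`). With D = 1 - z(eˣ - 1)(eʸ - 1), the solution is
P(α) = e^{αx} D^{-α}, J = (1 + z(eʸ - 1))/D and their mirror images (`isHookSystem_closedForm`),
whence the closed form z e^{αx+βy} D^{-(α+β)}.

For the enumeration at fixed size, expand this in powers of z. The coefficient of z^{k+1} is (α+β)_k
/ k! times e^{αx}(eˣ - 1)^k e^{βy}(eʸ - 1)^k, and e^{qx}(eˣ - 1)^k / k! is the exponential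
generating series of S_{2,q}(n+1, k+1) (`factorial_mul_qStirling`), because both sides obey the same
recurrence. -/

namespace MvPowerSeries

/-! ### Calculus of substitution into multivariate power series. -/

variable {σ R : Type*} [CommRing R]

/-- The order of `g ^ m` is at least `m`, so divisibility by every power kills each coefficient in
turn. -/
theorem eq_zero_of_forall_pow_dvd {f g : MvPowerSeries σ R} (hg : constantCoeff g = 0)
    (h : ∀ m : ℕ, g ^ m ∣ f) : f = 0 := by
  ext n
  obtain ⟨k, hk⟩ := h (n.degree + 1)
  rw [hk, coeff_zero]
  apply coeff_of_lt_order
  calc (n.degree : ℕ∞) < ((n.degree + 1 : ℕ) : ℕ∞) := by exact_mod_cast Nat.lt_succ_self _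
    _ ≤ (g ^ (n.degree + 1)).order := by
      refine le_trans ?_ (le_order_pow _)
      have : 1 ≤ g.order := one_le_order_iff_constCoeff_eq_zero.2 hg
      simpa using nsmul_le_nsmul_right this (n.degree + 1)
    _ ≤ _ := le_trans le_self_add le_order_mul

/-- The chain rule is known for polynomials. Replacing `f` by a truncation changes both sides only
by multiples of `g ^ m`, with `m` arbitrary. -/
theorem pderiv_subst {g : MvPowerSeries σ R} (hg : constantCoeff g = 0) (f : PowerSeries R)
    (i : σ) :
    pderiv R i (f.subst g) = (PowerSeries.derivative R f).subst g * pderiv R i g := by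
  have hs : PowerSeries.HasSubst g := .of_constantCoeff_zero hg
  rw [← sub_eq_zero]
  refine eq_zero_of_forall_pow_dvd hg fun m => ?_
  have hdvd : (PowerSeries.X : PowerSeries R) ^ (m + 1) ∣
      f - (PowerSeries.trunc (m + 1) f : Polynomial R) := by
    rw [PowerSeries.X_pow_dvd_iff]
    intro k hk
    simp [PowerSeries.coeff_trunc, hk]
  obtain ⟨h, hh⟩ := hdvd
  rw [sub_eq_iff_eq_add'] at hh
  set p := PowerSeries.trunc (m + 1) f
  have hp : pderiv R i ((p : PowerSeries R).subst g) =
      (PowerSeries.derivative R (p : PowerSeries R)).subst g * pderiv R i g := by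
    simp [PowerSeries.subst_coe hs, PowerSeries.derivative_coe,
      Derivation.comp_aeval_eq (a := g) (pderiv R i) p, smul_eq_mul]
  rw [hh, PowerSeries.subst_add hs, map_add, hp, PowerSeries.subst_mul hs, PowerSeries.subst_pow hs,
    PowerSeries.subst_X hs, map_add, Derivation.leibniz, Derivation.leibniz,
    PowerSeries.subst_add hs, PowerSeries.subst_add hs]
  have hn : ((m + 1 : ℕ) : PowerSeries R).subst g = ((m + 1 : ℕ) : MvPowerSeries σ R) := by
    rw [← PowerSeries.coe_substAlgHom hs, map_natCast]
  simp only [smul_eq_mul, PowerSeries.subst_mul hs, PowerSeries.subst_pow hs,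
    PowerSeries.subst_X hs, Derivation.leibniz_pow, PowerSeries.derivative_X, add_tsub_cancel_right, nsmul_eq_mul, mul_one,
    hn]
  -- For the remainder `X ^ (m + 1) * h`, the two terms with the factor `m + 1` cancel; what is left
  -- is `g ^ m` times this witness.
  refine ⟨g * pderiv R i (h.subst g) - g * (PowerSeries.derivative R h).subst g * pderiv R i g, ?_⟩
  ring

theorem dvd_subst_sub {g : MvPowerSeries σ R} (hg : constantCoeff g = 0) (f : PowerSeries R) :
    g ∣ f.subst g - C (PowerSeries.constantCoeff f) := by
  have hs : PowerSeries.HasSubst g := .of_constantCoeff_zero hg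
  obtain ⟨h, hh⟩ := PowerSeries.X_dvd_iff.2
    (show PowerSeries.constantCoeff (f - PowerSeries.C (PowerSeries.constantCoeff f)) = 0 by simp)
  refine ⟨h.subst g, ?_⟩
  have := congrArg (PowerSeries.subst g) hh
  rwa [PowerSeries.subst_sub hs, PowerSeries.subst_C, PowerSeries.subst_mul hs,
    PowerSeries.subst_X hs] at this

theorem constantCoeff_subst_of_constantCoeff_eq_zero {g : MvPowerSeries σ R}
    (hg : constantCoeff g = 0) (f : PowerSeries R) :
    constantCoeff (f.subst g) = PowerSeries.constantCoeff f := by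
  obtain ⟨k, hk⟩ := dvd_subst_sub hg f
  have := congrArg constantCoeff hk
  simp [hg, sub_eq_zero] at this
  exact this

variable [Algebra ℚ R]

theorem isAddTorsionFree_of_algebraRat (R : Type*) [CommRing R] [Algebra ℚ R] :
    IsAddTorsionFree R := IsAddTorsionFree.of_module_rat R

theorem eq_one_of_pderiv_eq_zero {f : MvPowerSeries σ R} (h : ∀ i, pderiv R i f = 0)
    (hc : constantCoeff f = 1) : f = 1 := by
  have := isAddTorsionFree_of_algebraRat R
  exact pderiv.ext (fun i => by rw [h i, pderiv_one]) (by simp [hc])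

theorem pderiv_exp_subst {g : MvPowerSeries σ R} (hg : constantCoeff g = 0) (i : σ) :
    pderiv R i ((PowerSeries.exp R).subst g) = (PowerSeries.exp R).subst g * pderiv R i g := by
  rw [pderiv_subst hg, PowerSeries.derivative_exp]

theorem exp_subst_mul_exp_subst_neg {f : MvPowerSeries σ R} (hf : constantCoeff f = 0) :
    (PowerSeries.exp R).subst f * (PowerSeries.exp R).subst (-f) = 1 := by
  refine eq_one_of_pderiv_eq_zero (fun i => ?_) ?_
  · rw [Derivation.leibniz, pderiv_exp_subst hf, pderiv_exp_subst (by simp [hf]), map_neg]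
    simp only [smul_eq_mul]; ring
  · rw [map_mul, constantCoeff_subst_of_constantCoeff_eq_zero hf,
      constantCoeff_subst_of_constantCoeff_eq_zero (by simp [hf])]
    simp

/-- The product of the exponentials of `f + g`, `-f` and `-g` has zero partial derivatives and
constant term 1, hence equals 1. -/
theorem exp_subst_add {f g : MvPowerSeries σ R} (hf : constantCoeff f = 0)
    (hg : constantCoeff g = 0) :
    (PowerSeries.exp R).subst (f + g) =
      (PowerSeries.exp R).subst f * (PowerSeries.exp R).subst g := by
  have key : (PowerSeries.exp R).subst (f + g) * (PowerSeries.exp R).subst (-f) *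
      (PowerSeries.exp R).subst (-g) = 1 := by
    refine eq_one_of_pderiv_eq_zero (fun i => ?_) ?_
    · rw [Derivation.leibniz, Derivation.leibniz, pderiv_exp_subst (g := f + g) (by simp [hf, hg]),
        pderiv_exp_subst (g := -f) (by simp [hf]), pderiv_exp_subst (g := -g) (by simp [hg]), map_neg,
        map_neg, map_add]
      simp only [smul_eq_mul]; ring
    · rw [map_mul, map_mul, constantCoeff_subst_of_constantCoeff_eq_zero (by simp [hf, hg]),
        constantCoeff_subst_of_constantCoeff_eq_zero (by simp [hf]),
        constantCoeff_subst_of_constantCoeff_eq_zero (by simp [hg])]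
      simp
  have h1 := exp_subst_mul_exp_subst_neg hf
  have h2 := exp_subst_mul_exp_subst_neg hg
  linear_combination (PowerSeries.exp R).subst f * (PowerSeries.exp R).subst g * key
    - (PowerSeries.exp R).subst (f + g) * h1 -
    (PowerSeries.exp R).subst (f + g) * (PowerSeries.exp R).subst f *
      (PowerSeries.exp R).subst (-f) * h2

end MvPowerSeries

/-! ### The binomial series and its differential equation. -/

section BinomSeries

variable {R : Type*} [CommRing R] [Algebra ℚ R]

theorem coeff_binomSeries (r : R) (n : ℕ) : PowerSeries.coeff n (binomSeries r) =
    algebraMap ℚ R (1 / n !) * (descPochhammer R n).eval r := PowerSeries.coeff_mk _ _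

theorem constantCoeff_binomSeries (r : R) : PowerSeries.constantCoeff (binomSeries r) = 1 := by
  rw [← PowerSeries.coeff_zero_eq_constantCoeff_apply, coeff_binomSeries]; simp

theorem binomSeries_add (r s : R) : binomSeries (r + s) = binomSeries r * binomSeries s := by
  -- This structure makes `R` a binomial ring, so that the Vandermonde identity for
  -- `PowerSeries.binomialSeries` applies.
  let _ : Module ℚ≥0 R := Module.compHom R (algebraMap ℚ≥0 ℚ)
  have h (r : R) : binomSeries r = PowerSeries.binomialSeries R r := by
    ext n
    rw [coeff_binomSeries, PowerSeries.binomialSeries_coeff, smul_eq_mul, mul_one]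
    have := Ring.descPochhammer_eq_factorial_smul_choose r n
    have h2 : (descPochhammer R n).eval r = (descPochhammer ℤ n).smeval r := by
      rw [← Polynomial.aeval_eq_smeval, Polynomial.aeval_def, Polynomial.eval₂_eq_eval_map,
        descPochhammer_map]
    rw [h2, this, nsmul_eq_mul, ← mul_assoc, ← map_natCast (algebraMap ℚ R), ← map_mul]
    simp [Nat.factorial_ne_zero]
  rw [h, h, h, PowerSeries.binomialSeries_add]

theorem one_add_X_mul_derivative_binomSeries (r : R) :
    (1 + PowerSeries.X) * PowerSeries.derivative R (binomSeries r) =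
      PowerSeries.C r * binomSeries r := by
  have hfac (n : ℕ) : algebraMap ℚ R (1 / (n + 1)!) * (n + 1) = algebraMap ℚ R (1 / n !) := by
    rw [← Nat.cast_succ, ← map_natCast (algebraMap ℚ R), ← map_mul, Nat.factorial_succ]
    congr 1
    push_cast
    field_simp
  have hd (n : ℕ) : PowerSeries.coeff n (PowerSeries.derivative R (binomSeries r)) =
      algebraMap ℚ R (1 / n !) * (descPochhammer R (n + 1)).eval r := by
    rw [PowerSeries.coeff_derivative, coeff_binomSeries, mul_right_comm, hfac]
  ext n
  rw [add_mul, one_mul, map_add, PowerSeries.coeff_C_mul, hd, coeff_binomSeries]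
  cases n with
  | zero => simp
  | succ n =>
    rw [PowerSeries.coeff_succ_X_mul, hd, descPochhammer_succ_right R (n + 1), ← hfac n]
    simp
    ring

end BinomSeries

/-! ### The differential system: uniqueness, then an explicit solution. -/

section DifferentialSystem

open MvPowerSeries

variable {R : Type*} [CommRing R]

/-- The differential system satisfied by the generating series of the trees hanging from a hook
(`P` to the left and `Q` to the right) and of the trees hanging from a left branch (`J`) or from a
right branch (`K`). -/
structure IsHookSystem (P Q : R → MvPowerSeries (Fin 3) R) (J K : MvPowerSeries (Fin 3) R) :
    Prop where
  pderiv_P : ∀ α, pderiv R 0 (P α) = C α * (P α * J)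
  pderiv_Q : ∀ β, pderiv R 1 (Q β) = C β * (K * Q β)
  pderiv_J : pderiv R 1 J = X 2 * (P 1 * Q 1)
  pderiv_K : pderiv R 0 K = X 2 * (P 1 * Q 1)
  dvd_P : ∀ α, X 0 ∣ P α - 1
  dvd_Q : ∀ β, X 1 ∣ Q β - 1
  dvd_J : X 1 ∣ J - 1
  dvd_K : X 0 ∣ K - 1

/-- Equality of the coefficients whose degree in the variables `0` and `1` is less than `d`. -/
def AgreeBelow (d : ℕ) (f g : MvPowerSeries (Fin 3) R) : Prop :=
  ∀ n : Fin 3 →₀ ℕ, n 0 + n 1 < d → coeff n f = coeff n g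

theorem AgreeBelow.mul {d : ℕ} {f f' g g' : MvPowerSeries (Fin 3) R} (hf : AgreeBelow d f f')
    (hg : AgreeBelow d g g') : AgreeBelow d (f * g) (f' * g') := by
  classical
  intro n hn
  rw [coeff_mul, coeff_mul]
  refine sum_congr rfl fun p hp => ?_
  obtain rfl := mem_antidiagonal.1 hp
  simp only [Finsupp.add_apply] at hn
  rw [hf p.1 (by omega), hg p.2 (by omega)]

theorem AgreeBelow.refl (d : ℕ) (f : MvPowerSeries (Fin 3) R) : AgreeBelow d f f := fun _ _ => rfl

theorem eq_of_forall_agreeBelow {f g : MvPowerSeries (Fin 3) R} (h : ∀ d, AgreeBelow d f g) :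
    f = g := by
  ext n
  exact h (n 0 + n 1 + 1) n (by omega)

/-- Integration gains one degree: a coefficient with `X i` present is read off the derivative, and
one without `X i` is fixed by the initial condition `hd`. -/
theorem AgreeBelow.of_pderiv [Algebra ℚ R] {d : ℕ} {f g : MvPowerSeries (Fin 3) R} {i : Fin 3}
    (hi : i = 0 ∨ i = 1) (h : AgreeBelow d (pderiv R i f) (pderiv R i g)) (hd : X i ∣ f - g) :
    AgreeBelow (d + 1) f g := by
  intro n hn
  by_cases h0 : n i = 0
  · have := X_dvd_iff.1 hd n h0
    rwa [map_sub, sub_eq_zero] at this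
  · obtain ⟨m, rfl⟩ : ∃ m, n = m + Finsupp.single i 1 :=
      ⟨n - Finsupp.single i 1, (tsub_add_cancel_of_le (by simpa using by omega)).symm⟩
    have := h m (by rcases hi with rfl | rfl <;> simp at hn <;> omega)
    rw [coeff_pderiv, coeff_pderiv] at this
    -- Integration divides by the exponent, which is invertible in a ℚ-algebra.
    have hu : IsUnit ((m i : R) + 1) := by
      have : IsUnit (algebraMap ℚ R ((m i : ℚ) + 1)) :=
        (IsUnit.mk0 _ (by positivity)).map _
      simpa using this
    exact hu.mul_right_cancel this

/-- Every derivative in the system is a product of the unknowns with fixed series, so agreement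
below degree `d` in x and y passes to the derivatives and then to degree `d + 1`. The degree in z
plays no role. -/
theorem IsHookSystem.unique [Algebra ℚ R] {P Q P' Q' : R → MvPowerSeries (Fin 3) R}
    {J K J' K' : MvPowerSeries (Fin 3) R} (h : IsHookSystem P Q J K)
    (h' : IsHookSystem P' Q' J' K') :
    P = P' ∧ Q = Q' ∧ J = J' ∧ K = K' := by
  have dvd {i : Fin 3} {f g : MvPowerSeries (Fin 3) R} (hf : X i ∣ f - 1) (hg : X i ∣ g - 1) :
      X i ∣ f - g := by
    have := dvd_sub hf hg
    rwa [sub_sub_sub_cancel_right] at this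
  have key : ∀ d, (∀ α, AgreeBelow d (P α) (P' α)) ∧ (∀ β, AgreeBelow d (Q β) (Q' β)) ∧
      AgreeBelow d J J' ∧ AgreeBelow d K K' := by
    intro d
    induction d with
    | zero => simp [AgreeBelow]
    | succ d ih =>
      obtain ⟨hP, hQ, hJ, hK⟩ := ih
      refine ⟨fun α => .of_pderiv (i := 0) (.inl rfl) ?_ (dvd (h.dvd_P α) (h'.dvd_P α)),
        fun β => .of_pderiv (i := 1) (.inr rfl) ?_ (dvd (h.dvd_Q β) (h'.dvd_Q β)),
        .of_pderiv (i := 1) (.inr rfl) ?_ (dvd h.dvd_J h'.dvd_J),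
        .of_pderiv (i := 0) (.inl rfl) ?_ (dvd h.dvd_K h'.dvd_K)⟩
      · rw [h.pderiv_P, h'.pderiv_P]
        exact (AgreeBelow.refl _ _).mul ((hP α).mul hJ)
      · rw [h.pderiv_Q, h'.pderiv_Q]
        exact (AgreeBelow.refl _ _).mul (hK.mul (hQ β))
      · rw [h.pderiv_J, h'.pderiv_J]
        exact (AgreeBelow.refl _ _).mul ((hP 1).mul (hQ 1))
      · rw [h.pderiv_K, h'.pderiv_K]
        exact (AgreeBelow.refl _ _).mul ((hP 1).mul (hQ 1))
  exact ⟨funext fun α => eq_of_forall_agreeBelow fun d => (key d).1 α,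
    funext fun β => eq_of_forall_agreeBelow fun d => (key d).2.1 β,
    eq_of_forall_agreeBelow fun d => (key d).2.2.1, eq_of_forall_agreeBelow fun d => (key d).2.2.2⟩

variable {σ : Type*}

theorem constantCoeff_smul_X (α : R) (i : σ) :
    constantCoeff (α • X i : MvPowerSeries σ R) = 0 := by
  rw [smul_eq_C_mul]; simp

variable [Algebra ℚ R]

/-- The series `e ^ (α X i)`. -/
noncomputable def expVar (α : R) (i : σ) : MvPowerSeries σ R := (PowerSeries.exp R).subst (α • X i)

theorem pderiv_expVar_self (α : R) (i : σ) : pderiv R i (expVar α i) = C α * expVar α i := by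
  rw [expVar, pderiv_exp_subst (constantCoeff_smul_X α i), Derivation.map_smul, pderiv_X_self,
    smul_eq_C_mul 1,
    mul_one, mul_comm]

theorem pderiv_expVar_of_ne (α : R) {i j : σ} (h : j ≠ i) : pderiv R i (expVar α j) = 0 := by
  rw [expVar, pderiv_exp_subst (constantCoeff_smul_X α j), Derivation.map_smul, pderiv_X_of_ne h]
  simp

theorem X_dvd_expVar_sub_one (α : R) (i : σ) : X i ∣ expVar α i - 1 := by
  have := dvd_subst_sub (constantCoeff_smul_X α i) (PowerSeries.exp R)
  rw [PowerSeries.constantCoeff_exp, map_one] at this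
  refine dvd_trans ?_ this
  rw [smul_eq_C_mul]
  exact dvd_mul_left _ _

theorem binomSeries_subst_add {u : MvPowerSeries σ R} (hu : constantCoeff u = 0) (r s : R) :
    (binomSeries (r + s)).subst u = (binomSeries r).subst u * (binomSeries s).subst u := by
  rw [binomSeries_add, PowerSeries.subst_mul (.of_constantCoeff_zero hu)]

theorem dvd_binomSeries_subst_sub_one {u : MvPowerSeries σ R} (hu : constantCoeff u = 0) (r : R) :
    u ∣ (binomSeries r).subst u - 1 := by
  simpa [constantCoeff_binomSeries] using dvd_subst_sub hu (binomSeries r)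

theorem one_add_mul_pderiv_binomSeries_subst {u : MvPowerSeries σ R} (hu : constantCoeff u = 0)
    (r : R) (i : σ) : (1 + u) * pderiv R i ((binomSeries r).subst u) =
      C r * (binomSeries r).subst u * pderiv R i u := by
  have hs : PowerSeries.HasSubst u := .of_constantCoeff_zero hu
  have := congrArg (PowerSeries.subst u) (one_add_X_mul_derivative_binomSeries r)
  rw [PowerSeries.subst_mul hs, PowerSeries.subst_mul hs, PowerSeries.subst_add hs,
    PowerSeries.subst_X hs, PowerSeries.subst_C, ← PowerSeries.coe_substAlgHom hs, map_one] at this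
  rw [PowerSeries.coe_substAlgHom hs] at this
  rw [pderiv_subst hu, ← this]
  ring

/-- Provides an explicit inverse of `1 + u`, which turns the binomial differential equation into a
formula for the derivative. -/
theorem one_add_mul_binomSeries_neg_one_subst {u : MvPowerSeries σ R} (hu : constantCoeff u = 0) :
    (1 + u) * (binomSeries (-1 : R)).subst u = 1 := by
  refine eq_one_of_pderiv_eq_zero (fun i => ?_) ?_
  · rw [Derivation.leibniz, smul_eq_mul, one_add_mul_pderiv_binomSeries_subst hu, map_add,
      pderiv_one, smul_eq_mul, map_neg, map_one]
    ring
  · rw [map_mul, constantCoeff_subst_of_constantCoeff_eq_zero hu, constantCoeff_binomSeries]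
    simp [hu]

theorem pderiv_binomSeries_subst {u : MvPowerSeries σ R} (hu : constantCoeff u = 0)
    (r : R) (i : σ) : pderiv R i ((binomSeries r).subst u) =
      C r * (binomSeries r).subst u * (binomSeries (-1 : R)).subst u * pderiv R i u := by
  linear_combination (binomSeries (-1 : R)).subst u * one_add_mul_pderiv_binomSeries_subst hu r i -
    pderiv R i ((binomSeries r).subst u) * one_add_mul_binomSeries_neg_one_subst hu

/-- The series `z (e ^ x - 1) (1 - e ^ y)`. -/
noncomputable def hookKernel (i j k : σ) : MvPowerSeries σ R :=
  -(X k * (expVar 1 i - 1) * (expVar 1 j - 1))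

theorem constantCoeff_hookKernel (i j k : σ) :
    constantCoeff (hookKernel i j k : MvPowerSeries σ R) = 0 := by
  simp [hookKernel]

theorem hookKernel_comm (i j k : σ) :
    (hookKernel i j k : MvPowerSeries σ R) = hookKernel j i k := by
  rw [hookKernel, hookKernel]; ring

theorem pderiv_hookKernel {i j k : σ} (hij : j ≠ i) (hik : k ≠ i) :
    pderiv R i (hookKernel i j k) = -(X k * expVar 1 i * (expVar 1 j - 1)) := by
  rw [hookKernel, map_neg, Derivation.leibniz, Derivation.leibniz, map_sub, map_sub, pderiv_one,
    pderiv_expVar_self, pderiv_expVar_of_ne _ hij, pderiv_X_of_ne hik]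
  simp only [smul_eq_mul, map_one]
  ring

theorem X_dvd_hookKernel (i j k : σ) : X i ∣ (hookKernel i j k : MvPowerSeries σ R) := by
  rw [hookKernel, dvd_neg]
  exact ((X_dvd_expVar_sub_one 1 i).mul_left _).mul_right _

/-- The closed form of the generating series of the trees hanging from a hook. -/
noncomputable def hookBranchSeries (i j k : σ) (α : R) : MvPowerSeries σ R :=
  expVar α i * (binomSeries (-α)).subst (hookKernel i j k)

/-- The closed form of the generating series of the trees hanging from a branch. -/
noncomputable def branchHookSeries (i j k : σ) : MvPowerSeries σ R :=
  (1 + X k * (expVar 1 j - 1)) * (binomSeries (-1 : R)).subst (hookKernel i j k)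

/-- For D = 1 + `hookKernel`, the logarithmic derivative is α(1 + z eˣ(eʸ - 1)/D), and D + z eˣ(eʸ -
1) = 1 + z(eʸ - 1). -/
theorem pderiv_hookBranchSeries {i j k : σ} (hij : j ≠ i) (hik : k ≠ i) (α : R) :
    pderiv R i (hookBranchSeries i j k α) =
      C α * (hookBranchSeries i j k α * branchHookSeries i j k) := by
  have h0 := constantCoeff_hookKernel (R := R) i j k
  have h1 := one_add_mul_binomSeries_neg_one_subst h0
  rw [hookBranchSeries, branchHookSeries, Derivation.leibniz, pderiv_expVar_self,
    pderiv_binomSeries_subst h0, pderiv_hookKernel hij hik]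
  simp only [smul_eq_mul, map_neg]
  have h2 : (hookKernel i j k : MvPowerSeries σ R) = -(X k * (expVar 1 i - 1) * (expVar 1 j - 1)) :=
    rfl
  set u : MvPowerSeries σ R := hookKernel i j k
  set B : MvPowerSeries σ R := (binomSeries (-1 : R)).subst u
  set B' : MvPowerSeries σ R := (binomSeries (-α)).subst u
  linear_combination (-C α * expVar α i * B') * h1 + C α * expVar α i * B' * B * h2

/-- By the quotient rule the numerator over D² is z eʸ(D + (eˣ - 1)(1 + z(eʸ - 1))), which collapses
to z eˣ eʸ (with x, y, z the variables `i`, `j`, `k`). -/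
theorem pderiv_branchHookSeries {i j k : σ} (hij : i ≠ j) (hjk : k ≠ j) :
    pderiv R j (branchHookSeries i j k) =
      X k * (hookBranchSeries i j k 1 * hookBranchSeries j i k 1) := by
  have h0 := constantCoeff_hookKernel (R := R) i j k
  have h1 := one_add_mul_binomSeries_neg_one_subst h0
  have h3 := pderiv_hookKernel (R := R) hij hjk
  rw [hookBranchSeries, hookBranchSeries, branchHookSeries, hookKernel_comm j i k,
    Derivation.leibniz,
    pderiv_binomSeries_subst h0, hookKernel_comm i j k, h3, map_add, pderiv_one, Derivation.leibniz,
    pderiv_X_of_ne hjk, map_sub, pderiv_one, pderiv_expVar_self]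
  rw [hookKernel_comm i j k] at h1
  simp only [smul_eq_mul, map_neg, map_one]
  have h2 : (hookKernel j i k : MvPowerSeries σ R) = -(X k * (expVar 1 j - 1) * (expVar 1 i - 1)) :=
    rfl
  set u : MvPowerSeries σ R := hookKernel j i k
  set B : MvPowerSeries σ R := (binomSeries (-1 : R)).subst u
  linear_combination (-X k * expVar 1 j * B) * h1 + X k * expVar 1 j * B * B * h2

theorem X_dvd_hookBranchSeries_sub_one (i j k : σ) (α : R) :
    X i ∣ hookBranchSeries i j k α - 1 := by
  have h := (X_dvd_hookKernel i j k).trans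
    (dvd_binomSeries_subst_sub_one (constantCoeff_hookKernel (R := R) i j k) (-α))
  have := (h.mul_left (expVar α i)).add (X_dvd_expVar_sub_one α i)
  rw [hookBranchSeries]
  convert this using 1
  ring

theorem X_dvd_branchHookSeries_sub_one (i j k : σ) :
    X j ∣ (branchHookSeries i j k : MvPowerSeries σ R) - 1 := by
  have h : X j ∣ (hookKernel i j k : MvPowerSeries σ R) := by
    rw [hookKernel_comm]; exact X_dvd_hookKernel j i k
  have h := h.trans (dvd_binomSeries_subst_sub_one (constantCoeff_hookKernel (R := R) i j k) (-1))
  have := (h.mul_left (1 + X k * (expVar 1 j - 1))).add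
    ((X_dvd_expVar_sub_one (1 : R) j).mul_left (X k))
  rw [branchHookSeries]
  convert this using 1
  ring

theorem isHookSystem_closedForm :
    IsHookSystem (R := R) (hookBranchSeries 0 1 2) (hookBranchSeries 1 0 2)
      (branchHookSeries 0 1 2) (branchHookSeries 1 0 2) where
  pderiv_P α := pderiv_hookBranchSeries (by decide) (by decide) α
  pderiv_Q β := by
    rw [mul_comm (branchHookSeries 1 0 2)]
    exact pderiv_hookBranchSeries (by decide) (by decide) β
  pderiv_J := pderiv_branchHookSeries (by decide) (by decide)
  pderiv_K := by
    rw [mul_comm (hookBranchSeries 0 1 2 1)]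
    exact pderiv_branchHookSeries (by decide) (by decide)
  dvd_P α := X_dvd_hookBranchSeries_sub_one _ _ _ α
  dvd_Q β := X_dvd_hookBranchSeries_sub_one _ _ _ β
  dvd_J := X_dvd_branchHookSeries_sub_one _ _ _
  dvd_K := X_dvd_branchHookSeries_sub_one _ _ _

theorem X_mul_hookBranchSeries_mul (α β : R) :
    (X 2 * (hookBranchSeries 0 1 2 α * hookBranchSeries 1 0 2 β) : MvPowerSeries (Fin 3) R) =
      X 2 * (PowerSeries.exp R).subst (α • X 0 + β • X 1 : MvPowerSeries (Fin 3) R) *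
        (binomSeries (-(α + β))).subst (hookKernel 0 1 2 : MvPowerSeries (Fin 3) R) := by
  rw [exp_subst_add (constantCoeff_smul_X α _) (constantCoeff_smul_X β _), neg_add,
    binomSeries_subst_add (constantCoeff_hookKernel 0 1 2), hookBranchSeries, hookBranchSeries,
    hookKernel_comm 1 0 2, expVar, expVar]
  ring

end DifferentialSystem

/-- The bijections `f : V ≃ A` such that `f v < f u` whenever `r u v`. -/
abbrev DecrLabelings {V : Type*} (r : V → V → Prop) (A : Type*) [LT A] : Type _ :=
  {f : V ≃ A // ∀ u v, r u v → f v < f u}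

/-- The proportion of the bijections `V ≃ {1, …, n}` that are decreasing with respect to `r`. -/
noncomputable def decrDensity {V : Type*} (r : V → V → Prop) : ℚ :=
  Nat.card (DecrLabelings r (Fin (Nat.card V))) / (Nat.card V)!

/-! ### Densities of decreasing labellings: disjoint unions and added maxima. -/

section DecrDensity

variable {V W : Type*}

theorem card_decrLabelings_congr {r : V → V → Prop} {s : W → W → Prop} {A B : Type*} [LinearOrder A]
    [LinearOrder B] (e : r ≃r s) (g : A ≃o B) :
    Nat.card (DecrLabelings r A) = Nat.card (DecrLabelings s B) := by
  refine Nat.card_congr ((Equiv.equivCongr e.toEquiv g.toEquiv).subtypeEquiv fun f => ?_)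
  constructor
  · intro h u v huv
    exact g.lt_iff_lt.2 (h (e.symm u) (e.symm v) (by rw [← e.map_rel_iff]; simpa using huv))
  · intro h u v huv
    have h' : f (e.symm (e v)) < f (e.symm (e u)) :=
      g.lt_iff_lt.1 (h (e u) (e v) (e.map_rel_iff.2 huv))
    rwa [e.symm_apply_apply, e.symm_apply_apply] at h'

theorem decrDensity_congr {r : V → V → Prop} {s : W → W → Prop} (e : r ≃r s) :
    decrDensity r = decrDensity s := by
  have h := Nat.card_congr e.toEquiv
  rw [decrDensity, decrDensity, h, card_decrLabelings_congr e (OrderIso.refl _)]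

theorem card_decrLabelings (r : V → V → Prop) {A : Type*} [LinearOrder A] [Fintype A]
    (h : Fintype.card A = Nat.card V) :
    (Nat.card (DecrLabelings r A) : ℚ) = (Nat.card V)! * decrDensity r := by
  rw [card_decrLabelings_congr (RelIso.refl r) (Fintype.orderIsoFinOfCardEq A h).symm, decrDensity]
  field_simp

theorem decrDensity_of_isEmpty [IsEmpty V] (r : V → V → Prop) : decrDensity r = 1 := by
  have hr := card_decrLabelings r (A := Fin 0) (by simp)
  have : Nat.card (DecrLabelings r (Fin 0)) = 1 := by
    rw [Nat.card_eq_one_iff_unique]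
    exact ⟨⟨fun f g => Subtype.ext (Equiv.ext fun v => isEmptyElim v)⟩,
      ⟨⟨Equiv.equivOfIsEmpty _ _, fun v => isEmptyElim v⟩⟩⟩
  rw [this] at hr
  simpa using hr.symm

/-- Once the set `B` of labels used on the left summand is fixed, the two summands are labelled
independently, since `Sum.LiftRel` relates no element of one to an element of the other. -/
theorem card_decrLabelings_fiber (r : V → V → Prop) (s : W → W → Prop) {A : Type*} [LinearOrder A]
    [Fintype A] (B : Finset A) :
    Nat.card {F : DecrLabelings (Sum.LiftRel r s) A // ∀ a, a ∈ B ↔ ∃ v, F.1 (.inl v) = a} =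
      Nat.card (DecrLabelings r {a // a ∈ B}) * Nat.card (DecrLabelings s {a // ¬ a ∈ B}) := by
  rw [← Nat.card_prod]
  symm
  let glue : DecrLabelings r {a // a ∈ B} × DecrLabelings s {a // ¬ a ∈ B} →
      {F : DecrLabelings (Sum.LiftRel r s) A // ∀ a, a ∈ B ↔ ∃ v, F.1 (.inl v) = a} := fun p =>
    ⟨⟨(Equiv.sumCongr p.1.1 p.2.1).trans (Equiv.sumCompl fun a => a ∈ B), by
      rintro _ _ (⟨h⟩ | ⟨h⟩)
      · exact p.1.2 _ _ h
      · exact p.2.2 _ _ h⟩, by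
      intro a
      constructor
      · intro ha
        exact ⟨p.1.1.symm ⟨a, ha⟩, by simp⟩
      · rintro ⟨v, rfl⟩
        simp⟩
  refine Nat.card_congr (Equiv.ofBijective glue ⟨?_, ?_⟩)
  · rintro ⟨g, h⟩ ⟨g', h'⟩ heq
    have key (x : V ⊕ W) : (glue (g, h)).1.1 x = (glue (g', h')).1.1 x := by rw [heq]
    refine Prod.ext (Subtype.ext (Equiv.ext fun v => Subtype.ext ?_))
      (Subtype.ext (Equiv.ext fun w => Subtype.ext ?_))
    · simpa [glue] using key (.inl v)
    · simpa [glue] using key (.inr w)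
  · rintro ⟨⟨F, hF⟩, hB⟩
    have hr (w : W) : ¬ F (.inr w) ∈ B := by
      rw [hB]; simp
    refine ⟨⟨⟨Equiv.ofBijective (fun v => ⟨F (.inl v), (hB _).2 ⟨v, rfl⟩⟩) ⟨?_, ?_⟩, ?_⟩,
      ⟨Equiv.ofBijective (fun w => ⟨F (.inr w), hr w⟩) ⟨?_, ?_⟩, ?_⟩⟩, ?_⟩
    · intro u v h; simpa using h
    · rintro ⟨a, ha⟩
      obtain ⟨v, hv⟩ := (hB a).1 ha
      exact ⟨v, by simp [hv]⟩
    · intro u v h; exact hF _ _ (.inl h)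
    · intro u v h; simpa using h
    · rintro ⟨a, ha⟩
      obtain ⟨x | x, rfl⟩ := F.surjective a
      · exact absurd ((hB _).2 ⟨x, rfl⟩) ha
      · exact ⟨x, rfl⟩
    · intro u v h; exact hF _ _ (.inr h)
    · refine Subtype.ext (Subtype.ext (Equiv.ext ?_))
      rintro (x | x) <;> rfl

variable [Finite V] [Finite W]

/-- Sum over the label sets of the left summand: there are `(|V| + |W|).choose |V|` of the right
size, and this binomial coefficient is absorbed by the normalising factorials. -/
theorem decrDensity_sum (r : V → V → Prop) (s : W → W → Prop) :
    decrDensity (Sum.LiftRel r s) = decrDensity r * decrDensity s := by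
  classical
  have := Fintype.ofFinite V
  set A := Fin (Nat.card (V ⊕ W))
  have hA : Fintype.card A = Nat.card V + Nat.card W := by simp [A]
  have hcard := card_decrLabelings (Sum.LiftRel r s) (A := A) (by simp [A])
  let glue : DecrLabelings (Sum.LiftRel r s) A → Finset A := fun F =>
    univ.image fun v => F.1 (.inl v)
  have hglue (B : Finset A) (F : DecrLabelings (Sum.LiftRel r s) A) :
      glue F = B ↔ ∀ a, a ∈ B ↔ ∃ v, F.1 (.inl v) = a := by
    simp [glue, Finset.ext_iff, eq_comm]
  have h1 : (Nat.card (DecrLabelings (Sum.LiftRel r s) A) : ℚ) = ∑ B : Finset A,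
      (Nat.card (DecrLabelings r {a // a ∈ B}) *
        Nat.card (DecrLabelings s {a // ¬ a ∈ B}) : ℚ) := by
    rw [← Nat.card_congr (Equiv.sigmaFiberEquiv glue), Nat.card_sigma]
    push_cast
    refine sum_congr rfl fun B _ => ?_
    rw [← Nat.cast_mul, ← card_decrLabelings_fiber]
    exact congrArg _ (Nat.card_congr (Equiv.subtypeEquivRight fun F => hglue B F))
  have h2 : ∑ B : Finset A, (Nat.card (DecrLabelings r {a // a ∈ B}) *
        Nat.card (DecrLabelings s {a // ¬ a ∈ B}) : ℚ) =
      ∑ B ∈ powersetCard (Nat.card V) (univ : Finset A),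
        ((Nat.card V)! * decrDensity r) * ((Nat.card W)! * decrDensity s) := by
    symm
    -- A label set of the wrong size admits no bijection with `V`, so it contributes zero.
    apply sum_subset_zero_on_sdiff (subset_univ _)
    · intro B hB
      have : IsEmpty (DecrLabelings r {a // a ∈ B}) := by
        by_contra hne
        rw [not_isEmpty_iff] at hne
        obtain ⟨f⟩ := hne
        have := Nat.card_congr f.1
        simp at hB this
        omega
      simp
    · intro B hB
      have hB : #B = Nat.card V := by simpa using hB
      rw [card_decrLabelings r (by simpa using hB), card_decrLabelings s]
      rw [Fintype.card_subtype_compl, hA]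
      simp [hB]
  rw [h1, h2, sum_const, card_powersetCard, card_univ, hA, nsmul_eq_mul, Nat.card_sum] at hcard
  have h3 := Nat.add_choose_mul_factorial_mul_factorial (Nat.card V) (Nat.card W)
  have h4 : ((Nat.card V + Nat.card W)! : ℚ) ≠ 0 := by positivity
  apply mul_left_cancel₀ h4
  rw [← hcard, ← h3, Nat.choose_symm_add]
  push_cast
  ring

/-- The added element lies above all others and must take the largest label. The number of
labellings is unchanged while the factorial grows by the factor `|V| + 1`. -/
theorem decrDensity_option {r : V → V → Prop} {s : Option V → Option V → Prop}
    (h₁ : ∀ v, s none (some v)) (h₂ : ∀ u v, s (some u) (some v) ↔ r u v)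
    (h₃ : ∀ u, ¬ s u none) : decrDensity s = decrDensity r / (Nat.card V + 1) := by
  have := Fintype.ofFinite V
  have hc : Nat.card (Option V) = Nat.card V + 1 := by simp
  set n := Nat.card V
  have hs := card_decrLabelings s (A := Fin (n + 1)) (by rw [hc, Fintype.card_fin])
  have hr := card_decrLabelings r (A := Fin n) (by simp [n])
  have hcard : Nat.card (DecrLabelings s (Fin (n + 1))) = Nat.card (DecrLabelings r (Fin n)) := by
    symm
    let glue : DecrLabelings r (Fin n) → DecrLabelings s (Fin (n + 1)) := fun g =>
      ⟨(Equiv.optionCongr g.1).trans finSuccEquivLast.symm, by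
        rintro (_ | u) (_ | v) h
        · exact absurd h (h₃ _)
        · simp [Fin.castSucc_lt_last]
        · exact absurd h (h₃ _)
        · simpa using g.2 _ _ ((h₂ u v).1 h)⟩
    refine Nat.card_congr (Equiv.ofBijective glue ⟨?_, ?_⟩)
    · intro g g' h
      refine Subtype.ext (Equiv.ext fun v => ?_)
      have := congrArg (fun F : DecrLabelings s (Fin (n + 1)) => F.1 (some v)) h
      simpa [glue] using this
    · rintro ⟨F, hF⟩
      have hnone : F none = Fin.last n := by
        obtain ⟨_ | v, hv⟩ := F.surjective (Fin.last n)
        · exact hv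
        · have := hF _ _ (h₁ v)
          rw [hv] at this
          exact absurd this (Fin.le_last _).not_gt
      -- Since `F none` is the last label, deleting `none` and restoring it loses nothing.
      have hcongr : Equiv.optionCongr (Equiv.removeNone (F.trans finSuccEquivLast)) =
          F.trans finSuccEquivLast := by
        ext1 (_ | v)
        · simp [hnone]
        · rw [Equiv.optionCongr_apply, Option.map_some, Equiv.removeNone_some]
          cases h : (F.trans finSuccEquivLast) (some v) with
          | some x => exact ⟨x, rfl⟩
          | none =>
            rw [← show (F.trans finSuccEquivLast) none = none by simp [hnone]] at h
            exact absurd ((F.trans finSuccEquivLast).injective h) (by simp)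
      refine ⟨⟨Equiv.removeNone (F.trans finSuccEquivLast), fun u v h => ?_⟩, ?_⟩
      · have h' (w : V) : F (some w) =
            (Equiv.removeNone (F.trans finSuccEquivLast) w).castSucc := by
          have := congrArg (fun e => finSuccEquivLast.symm (e (some w))) hcongr
          simpa using this.symm
        have := hF _ _ ((h₂ u v).2 h)
        rw [h', h'] at this
        simpa using this
      · refine Subtype.ext (Equiv.ext fun x => ?_)
        simp [glue, hcongr]
  rw [hcard, hr, hc, Nat.factorial_succ] at hs
  have : (n ! : ℚ) ≠ 0 := by positivity
  have : (n + 1 : ℚ) ≠ 0 := by positivity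
  push_cast at hs
  field_simp
  apply mul_left_cancel₀ ‹(n ! : ℚ) ≠ 0›
  rw [hs]
  ring

end DecrDensity

/-! ### Prefix densities and child sets under decomposition at the root. -/

namespace BinTree

/-- The proper prefix relation on a finite set of addresses. -/
def prefixRel (s : Finset (List Bool)) (u v : s) : Prop := u.1 <+: v.1 ∧ u ≠ v

/-- The proportion of the labellings of the addresses in `s` that decrease from each address to
the addresses that extend it. -/
noncomputable def prefixDensity (s : Finset (List Bool)) : ℚ := decrDensity (prefixRel s)

theorem prefixDensity_empty : prefixDensity ∅ = 1 := decrDensity_of_isEmpty _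

theorem prefixDensity_insert_nil {s : Finset (List Bool)} (h : [] ∉ s) :
    prefixDensity (insert [] s) = prefixDensity s / (#s + 1) := by
  let r : Option s → Option s → Prop
    | none, some _ => True
    | some u, some v => prefixRel s u v
    | _, none => False
  have h₁ := decrDensity_option (r := prefixRel s) (s := r) (fun _ => trivial) (fun _ _ => Iff.rfl)
    (by rintro (_ | _) h <;> exact h)
  have hs (u : s) : u.1 ≠ [] := fun h' => h (h' ▸ u.2)
  let f : Option s → (insert [] s : Finset (List Bool)) := fun u =>
    u.elim ⟨[], mem_insert_self _ _⟩ fun v => ⟨v.1, mem_insert_of_mem v.2⟩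
  have hf : Function.Bijective f := by
    constructor
    · rintro (_ | u) (_ | v) h
      · rfl
      · exact absurd (congrArg Subtype.val h).symm (hs v)
      · exact absurd (congrArg Subtype.val h) (hs u)
      · exact congrArg some (Subtype.ext (show u.1 = v.1 from congrArg (fun x => x.1) h))
    · rintro ⟨v, hv⟩
      rcases mem_insert.1 hv with rfl | hv
      · exact ⟨none, rfl⟩
      · exact ⟨some ⟨v, hv⟩, rfl⟩
  rw [prefixDensity, ← decrDensity_congr (r := r) ⟨Equiv.ofBijective f hf, ?_⟩, h₁, prefixDensity]
  · simp
  · rintro u v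
    simp only [prefixRel, Equiv.ofBijective_apply, hf.injective.ne_iff]
    rcases u with _ | u <;> rcases v with _ | v
    · simp [r]
    · simp [r, f]
    · simp [r, f, hs]
    · simp [r, f, prefixRel]

/-- Addresses with different first steps are incomparable, so the prefix order is a disjoint sum. -/
theorem prefixDensity_cons_union (s t : Finset (List Bool)) :
    prefixDensity (s.image (List.cons false) ∪ t.image (List.cons true)) =
      prefixDensity s * prefixDensity t := by
  rw [prefixDensity, prefixDensity, prefixDensity, ← decrDensity_sum]
  let f : s ⊕ t → (s.image (List.cons false) ∪ t.image (List.cons true) : Finset (List Bool)) :=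
    Sum.elim (fun u => ⟨false :: u.1, mem_union_left _ (mem_image_of_mem _ u.2)⟩)
      fun u => ⟨true :: u.1, mem_union_right _ (mem_image_of_mem _ u.2)⟩
  have hf : Function.Bijective f := by
    constructor
    · have hval {x y} (h : f x = f y) : (f x).1 = (f y).1 := congrArg _ h
      rintro (u | u) (v | v) h
      · exact congrArg Sum.inl (Subtype.ext (List.cons_injective (hval h)))
      · exact absurd (List.cons.inj (hval h)).1 (by decide)
      · exact absurd (List.cons.inj (hval h)).1 (by decide)
      · exact congrArg Sum.inr (Subtype.ext (List.cons_injective (hval h)))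
    · rintro ⟨v, hv⟩
      rcases mem_union.1 hv with hv | hv
      · obtain ⟨w, hw, rfl⟩ := mem_image.1 hv
        exact ⟨.inl ⟨w, hw⟩, rfl⟩
      · obtain ⟨w, hw, rfl⟩ := mem_image.1 hv
        exact ⟨.inr ⟨w, hw⟩, rfl⟩
  refine (decrDensity_congr ⟨Equiv.ofBijective f hf, ?_⟩).symm
  intro u v
  simp only [prefixRel, Equiv.ofBijective_apply, hf.injective.ne_iff]
  have hl (u : s) : (f (.inl u)).1 = false :: u.1 := rfl
  have hr (u : t) : (f (.inr u)).1 = true :: u.1 := rfl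
  rcases u with u | u <;> rcases v with v | v <;>
    simp only [hl, hr, List.cons_prefix_cons, prefixRel, Sum.liftRel_inl_inl, Sum.liftRel_inr_inr,
      Sum.not_liftRel_inl_inr, Sum.not_liftRel_inr_inl, ne_eq, Sum.inl.injEq, Sum.inr.injEq,
      true_and, reduceCtorEq, false_and]

/-- The left (`a = false`) or right (`a = true`) children in a tree hanging to the left
(`b = false`) or right (`b = true`) of a further vertex. -/
def stepVerts (a b : Bool) (B : BinaryTree Unit) : Finset (List Bool) :=
  {v ∈ verts B | (b :: v).getLast? = some a}

theorem childVerts_node (a : Bool) (u : Unit) (l r : BinaryTree Unit) :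
    childVerts a (.node u l r) = (stepVerts a false l).image (List.cons false) ∪
      (stepVerts a true r).image (List.cons true) := by
  ext v
  rcases v with _ | ⟨_ | _, v⟩ <;> simp [childVerts, stepVerts, verts]

theorem stepVerts_nil (a b : Bool) : stepVerts a b .nil = ∅ := rfl

theorem childVerts_nil (a : Bool) : childVerts a .nil = ∅ := rfl

theorem nil_notMem_childVerts (a : Bool) (B : BinaryTree Unit) : [] ∉ childVerts a B := by
  simp [childVerts]

theorem stepVerts_of_ne {a b : Bool} (h : b ≠ a) (B : BinaryTree Unit) :
    stepVerts a b B = childVerts a B := by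
  ext v
  rcases v with _ | ⟨c, v⟩
  · simp [stepVerts, childVerts, h]
  · simp [stepVerts, childVerts]

theorem stepVerts_self_node (a : Bool) (u : Unit) (l r : BinaryTree Unit) :
    stepVerts a a (.node u l r) = insert [] (childVerts a (.node u l r)) := by
  ext v
  rcases v with _ | ⟨c, v⟩ <;> simp [stepVerts, childVerts, verts]

theorem card_cons_union (s t : Finset (List Bool)) :
    #(s.image (List.cons false) ∪ t.image (List.cons true)) = #s + #t := by
  rw [card_union_of_disjoint, card_image_of_injective _ List.cons_injective,
    card_image_of_injective _ List.cons_injective]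
  rw [disjoint_left]
  simp only [mem_image]
  grind

/-- The number of vertices of the leftmost (`a = false`) or rightmost (`a = true`) branch. -/
def depth (a : Bool) : BinaryTree Unit → ℕ
  | .nil => 0
  | .node _ l r => (if a then depth a r else depth a l) + 1

theorem replicate_mem_verts (a : Bool) (B : BinaryTree Unit) (k : ℕ) :
    List.replicate k a ∈ verts B ↔ k < depth a B := by
  induction B generalizing k with
  | nil => simp [verts, depth]
  | node u l r hl hr =>
    cases k with
    | zero => simp [verts, depth]
    | succ k =>
      rw [List.replicate_succ, cons_mem_verts, depth]
      cases a <;> simp_all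

theorem branchLength_add_one {a : Bool} {B : BinaryTree Unit} (hB : B ≠ .nil) :
    branchLength a B + 1 = depth a B := by
  have h : branch B a [] = (range (depth a B)).image fun k => List.replicate k a := by
    ext v
    simp only [branch, List.nil_append, mem_filter, mem_image, mem_range]
    constructor
    · rintro ⟨hv, k, rfl⟩
      exact ⟨k, (replicate_mem_verts a B k).1 hv, rfl⟩
    · rintro ⟨k, hk, rfl⟩
      exact ⟨(replicate_mem_verts a B k).2 hk, k, rfl⟩
  have hcard : #(branch B a []) = depth a B := by
    rw [h, card_image_of_injective, card_range]
    exact fun m n hmn => by simpa using congrArg List.length hmn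
  have hmem : [] ∈ branch B a [] := by
    rw [h]
    refine mem_image.2 ⟨0, ?_, rfl⟩
    cases B with
    | nil => exact absurd rfl hB
    | node u l r => simp [depth]
  rw [branchLength, card_erase_add_one hmem, hcard]

/-- The off-by-one disappears here: not counting the root leaves the full branch of the subtree,
which may be empty. -/
theorem branchLength_node (a : Bool) (u : Unit) (l r : BinaryTree Unit) :
    branchLength a (.node u l r) = depth a (if a then r else l) := by
  have := branchLength_add_one (a := a) (B := .node u l r) (by simp)
  cases a <;> simp_all [depth]

end BinTree

/-! ### Formal sums over binary trees and their derivatives. -/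

section TreeSum

open MvPowerSeries BinaryTree

variable {R : Type*} [CommRing R]

/-- All the terms have degree `d` in the variables `0` and `1`. -/
def IsHomogeneousXY (d : ℕ) (f : MvPowerSeries (Fin 3) R) : Prop :=
  ∀ n, coeff n f ≠ 0 → n 0 + n 1 = d

theorem IsHomogeneousXY.mul {d e : ℕ} {f g : MvPowerSeries (Fin 3) R} (hf : IsHomogeneousXY d f)
    (hg : IsHomogeneousXY e g) : IsHomogeneousXY (d + e) (f * g) := by
  classical
  intro n hn
  rw [coeff_mul] at hn
  obtain ⟨p, hp, h⟩ := exists_ne_zero_of_sum_ne_zero hn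
  obtain rfl := mem_antidiagonal.1 hp
  have h1 := hf _ (left_ne_zero_of_mul h)
  have h2 := hg _ (right_ne_zero_of_mul h)
  simp only [Finsupp.add_apply]
  omega

theorem isHomogeneousXY_sum {ι : Type*} {s : Finset ι} {d : ℕ}
    {f : ι → MvPowerSeries (Fin 3) R} (h : ∀ i ∈ s, IsHomogeneousXY d (f i)) :
    IsHomogeneousXY d (∑ i ∈ s, f i) := by
  intro n hn
  rw [map_sum] at hn
  obtain ⟨i, hi, h'⟩ := exists_ne_zero_of_sum_ne_zero hn
  exact h i hi n h'

theorem isHomogeneousXY_monomial {m : Fin 3 →₀ ℕ} {d : ℕ} (hm : m 0 + m 1 = d) (c : R) :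
    IsHomogeneousXY d (monomial m c) := by
  classical
  intro n hn
  rw [coeff_monomial] at hn
  rwa [(ite_ne_right_iff.1 hn).1]

/-- The formal sum of the series `W B` over all binary trees `B`, when `W B` is homogeneous of
degree the number of nodes of `B` in the variables `0` and `1`. -/
noncomputable def treeSum (W : BinaryTree Unit → MvPowerSeries (Fin 3) R) :
    MvPowerSeries (Fin 3) R :=
  fun n => ∑ B ∈ treesOfNumNodesEq (n 0 + n 1), coeff n (W B)

theorem coeff_treeSum (W : BinaryTree Unit → MvPowerSeries (Fin 3) R) (n : Fin 3 →₀ ℕ) :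
    coeff n (treeSum W) = ∑ B ∈ treesOfNumNodesEq (n 0 + n 1), coeff n (W B) := rfl

theorem agreeBelow_treeSum {W : BinaryTree Unit → MvPowerSeries (Fin 3) R}
    (hW : ∀ B, IsHomogeneousXY B.numNodes (W B)) (N : ℕ) :
    AgreeBelow N (treeSum W) (∑ d ∈ range N, ∑ B ∈ treesOfNumNodesEq d, W B) := by
  intro n hn
  rw [coeff_treeSum, map_sum, sum_eq_single (n 0 + n 1)]
  · rw [map_sum]
  · intro d _ hd
    rw [map_sum]
    refine sum_eq_zero fun B hB => ?_
    by_contra h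
    rw [mem_treesOfNumNodesEq] at hB
    exact hd (by rw [← hB, hW B n h])
  · intro h
    exact absurd (mem_range.2 hn) h

theorem sum_treesOfNumNodesEq_succ {M : Type*} [AddCommMonoid M] (n : ℕ)
    (f : BinaryTree Unit → M) :
    ∑ B ∈ treesOfNumNodesEq (n + 1), f B = ∑ p ∈ antidiagonal n,
      ∑ l ∈ treesOfNumNodesEq p.1, ∑ r ∈ treesOfNumNodesEq p.2, f (.node () l r) := by
  rw [treesOfNumNodesEq_succ, sum_biUnion]
  · refine sum_congr rfl fun p _ => ?_
    rw [sum_map, sum_product]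
    rfl
  · intro p _ q _ hpq
    simp only [Function.onFun, disjoint_left, mem_map, mem_product, mem_treesOfNumNodesEq,
      Prod.exists]
    rintro _ ⟨l, r, ⟨h1, h2⟩, rfl⟩ ⟨l', r', ⟨h3, h4⟩, h⟩
    injection h with _ hl hr
    subst hl hr
    exact hpq (Prod.ext (h1.symm.trans h3) (h2.symm.trans h4))

/-- A non-empty tree is a pair of subtrees with one node fewer in total, so this is a Cauchy
product. `F` is evaluated at non-empty trees only. -/
theorem sum_coeff_node {F V W : BinaryTree Unit → MvPowerSeries (Fin 3) R}
    {K : MvPowerSeries (Fin 3) R} (hK : IsHomogeneousXY 0 K)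
    (hV : ∀ B, IsHomogeneousXY B.numNodes (V B)) (hW : ∀ B, IsHomogeneousXY B.numNodes (W B))
    (hF : ∀ l r, F (.node () l r) = K * (V l * W r)) (n : Fin 3 →₀ ℕ) :
    ∑ B ∈ treesOfNumNodesEq (n 0 + n 1 + 1), coeff n (F B) =
      coeff n (K * (treeSum V * treeSum W)) := by
  have hsum {U : BinaryTree Unit → MvPowerSeries (Fin 3) R}
      (hU : ∀ B, IsHomogeneousXY B.numNodes (U B)) (d : ℕ) :
      IsHomogeneousXY d (∑ B ∈ treesOfNumNodesEq d, U B) :=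
    isHomogeneousXY_sum fun B hB => mem_treesOfNumNodesEq.1 hB ▸ hU B
  -- Replace both formal sums by finite ones, which agree with them in the degrees that can affect
  -- the coefficient of `n`.
  rw [(AgreeBelow.refl _ K).mul ((agreeBelow_treeSum hV _).mul (agreeBelow_treeSum hW _)) n
    (Nat.lt_succ_self _), sum_treesOfNumNodesEq_succ, sum_mul_sum, ← sum_product', mul_sum, map_sum]
  refine Eq.trans ?_ (sum_subset (s₁ := antidiagonal (n 0 + n 1)) ?_ ?_)
  · refine sum_congr rfl fun p _ => ?_
    rw [sum_mul_sum, mul_sum, map_sum]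
    refine sum_congr rfl fun l _ => ?_
    rw [mul_sum, map_sum]
    exact sum_congr rfl fun r _ => by rw [hF]
  · intro p hp
    rw [HasAntidiagonal.mem_antidiagonal] at hp
    simp only [mem_product, mem_range]
    omega
  -- A pair of sizes with the wrong total contributes nothing, by homogeneity.
  · intro p _ hp
    by_contra h
    have := hK.mul ((hsum hV p.1).mul (hsum hW p.2)) n h
    exact hp (HasAntidiagonal.mem_antidiagonal.2 (by omega))

theorem pderiv_treeSum {F V W : BinaryTree Unit → MvPowerSeries (Fin 3) R}
    {K : MvPowerSeries (Fin 3) R} (hK : IsHomogeneousXY 0 K)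
    (hV : ∀ B, IsHomogeneousXY B.numNodes (V B)) (hW : ∀ B, IsHomogeneousXY B.numNodes (W B))
    {i : Fin 3} (hi : i = 0 ∨ i = 1)
    (hF : ∀ l r, pderiv R i (F (.node () l r)) = K * (V l * W r)) :
    pderiv R i (treeSum F) = K * (treeSum V * treeSum W) := by
  ext n
  rw [← sum_coeff_node (F := fun B => pderiv R i (F B)) hK hV hW hF, coeff_pderiv, coeff_treeSum,
    sum_mul]
  refine sum_congr ?_ fun B _ => ?_
  · rcases hi with rfl | rfl
    · simp [add_right_comm]
    · simp [add_assoc]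
  · rw [coeff_pderiv]

/-- Modulo `X i` only the empty tree survives, which gives the initial conditions of the system. -/
theorem X_dvd_treeSum_sub_one {F : BinaryTree Unit → MvPowerSeries (Fin 3) R} {i : Fin 3}
    (hF : ∀ l r, X i ∣ F (.node () l r)) (hnil : F .nil = 1) : X i ∣ treeSum F - 1 := by
  classical
  rw [X_dvd_iff]
  intro n hn
  have hB (B : BinaryTree Unit) : coeff n (F B) = if B = .nil then coeff n 1 else 0 := by
    cases B with
    | nil => simp [hnil]
    | node u l r => simpa using X_dvd_iff.1 (hF l r) n hn
  rw [map_sub, coeff_treeSum, sum_congr rfl fun B _ => hB B, sum_ite_eq']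
  simp only [mem_treesOfNumNodesEq, numNodes]
  split_ifs with h
  · simp
  · rw [coeff_one, if_neg]
    · simp
    · rintro rfl
      simp at h

theorem pderiv_monomial_add_single {σ : Type*} (i : σ) (m : σ →₀ ℕ) (c : R) :
    pderiv R i (monomial (m + Finsupp.single i 1) c) = monomial m (c * (m i + 1)) := by
  classical
  ext n
  rw [coeff_pderiv, coeff_monomial, coeff_monomial]
  simp only [add_left_inj]
  split_ifs with h
  · rw [h]
  · simp

end TreeSum

/-! ### The recursion for weights of hanging subtrees. -/

namespace BinTree

open MvPowerSeries BinaryTree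

theorem card_childVerts_node (a : Bool) (u : Unit) (l r : BinaryTree Unit) :
    #(childVerts a (.node u l r)) = #(stepVerts a a (if a then r else l)) +
      #(childVerts a (if a then l else r)) := by
  rw [childVerts_node, card_cons_union]
  cases a
  · simp [stepVerts_of_ne]
  · simp [stepVerts_of_ne, add_comm]

theorem prefixDensity_childVerts_node (a : Bool) (u : Unit) (l r : BinaryTree Unit) :
    prefixDensity (childVerts a (.node u l r)) =
      prefixDensity (stepVerts a a (if a then r else l)) *
        prefixDensity (childVerts a (if a then l else r)) := by
  rw [childVerts_node, prefixDensity_cons_union]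
  cases a
  · simp [stepVerts_of_ne]
  · simp [stepVerts_of_ne, mul_comm]

theorem card_stepVerts_self_node (a : Bool) (u : Unit) (l r : BinaryTree Unit) :
    #(stepVerts a a (.node u l r)) = #(childVerts a (.node u l r)) + 1 := by
  rw [stepVerts_self_node, card_insert_of_notMem (nil_notMem_childVerts _ _)]

theorem prefixDensity_stepVerts_self_node (a : Bool) (u : Unit) (l r : BinaryTree Unit) :
    prefixDensity (stepVerts a a (.node u l r)) =
      prefixDensity (childVerts a (.node u l r)) / (#(childVerts a (.node u l r)) + 1) := by
  rw [stepVerts_self_node, prefixDensity_insert_nil (nil_notMem_childVerts _ _)]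

/-- In a hanging tree every vertex, the root included, is a left or a right child. This makes the
weights homogeneous of degree the number of nodes. -/
theorem card_stepVerts_add_card_childVerts (a : Bool) (B : BinaryTree Unit) :
    #(stepVerts a a B) + #(childVerts (!a) B) = B.numNodes := by
  cases B with
  | nil => rfl
  | node u l r =>
    rw [card_stepVerts_self_node, ← card_childVerts (.node u l r) (by simp)]
    cases a <;> simp <;> omega

variable {R : Type*} [CommRing R] [Algebra ℚ R]

/-- The variable recording the number of left (`a = false`) or right (`a = true`) children. -/
def axis (a : Bool) : Fin 3 := if a then 1 else 0

/-- The weight of a tree hanging to the left (`a = false`) or right (`a = true`) of a further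
vertex, where `m` tells which part of the hook of its root belongs to a hook above, and `α` records
the length of the branch of the root in the direction `a`. -/
noncomputable def treeWeight (a : Bool) (m : Option Bool) (α : R) (B : BinaryTree Unit) :
    MvPowerSeries (Fin 3) R :=
  monomial (Finsupp.single (axis a) #(stepVerts a a B) +
      Finsupp.single (axis !a) #(childVerts (!a) B) + Finsupp.single 2 #(hookRootsAux m B))
    (algebraMap ℚ R (prefixDensity (stepVerts a a B) * prefixDensity (childVerts (!a) B)) *
      α ^ depth a B)

theorem isHomogeneousXY_treeWeight (a : Bool) (m : Option Bool) (α : R) (B : BinaryTree Unit) :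
    IsHomogeneousXY B.numNodes (treeWeight a m α B) := by
  refine isHomogeneousXY_monomial ?_ _
  rw [← card_stepVerts_add_card_childVerts a B]
  cases a <;> simp [axis, add_comm]

theorem treeWeight_nil (a : Bool) (m : Option Bool) (α : R) : treeWeight a m α .nil = 1 := by
  simp [treeWeight, stepVerts_nil, childVerts_nil, prefixDensity_empty, depth, hookRootsAux]

theorem X_dvd_treeWeight_node (a : Bool) (m : Option Bool) (α : R) (u : Unit)
    (l r : BinaryTree Unit) : X (axis a) ∣ treeWeight a m α (.node u l r) := by
  classical
  rw [X_dvd_iff]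
  intro n hn
  rw [treeWeight, coeff_monomial, if_neg]
  rintro rfl
  cases a <;> simp [axis, card_stepVerts_self_node] at hn

theorem algebraMap_div_mul_pow_mul (p q p' q' : ℚ) (c d e : ℕ) (α : R) :
    algebraMap ℚ R (p * q / (c + 1) * (p' * q')) * α ^ (d + 1) * (c + 1) =
      α * (algebraMap ℚ R (p * q') * α ^ d * (algebraMap ℚ R (p' * q) * 1 ^ e)) := by
  have h : algebraMap ℚ R (p * q / (c + 1) * (p' * q')) * (c + 1) =
      algebraMap ℚ R (p * q') * algebraMap ℚ R (p' * q) := by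
    rw [← map_mul, ← map_natCast (algebraMap ℚ R) c, ← map_one (algebraMap ℚ R), ← map_add,
      ← map_mul]
    congr 1
    field_simp
  rw [one_pow, pow_succ]
  linear_combination α ^ (d + 1) * h

theorem single_add_single_add_single {σ : Type*} (i j k : σ) (a b c d e f g : ℕ) :
    Finsupp.single i (a + b) + Finsupp.single j (c + d) + Finsupp.single k (e + f + g) =
      Finsupp.single k e + (Finsupp.single i a + Finsupp.single j d + Finsupp.single k f +
        (Finsupp.single j c + Finsupp.single i b + Finsupp.single k g)) := by
  simp only [Finsupp.single_add]
  abel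

/-- The root carries the greatest label in direction `a`, so the density contains 1/(c + 1), where c
counts the `a`-children below it; the derivative supplies c + 1. The subtree in direction `a`
prolongs the recorded branch, hence one factor `α`; the other subtree starts an unrecorded branch,
hence parameter 1. The exponent `k` is the number of hooks rooted at this vertex. -/
theorem pderiv_treeWeight_node {a : Bool} {m m₁ m₂ : Option Bool} {k : ℕ} {u : Unit}
    {l r : BinaryTree Unit} (α : R)
    (h : #(hookRootsAux m (.node u l r)) = k + #(hookRootsAux m₁ (if a then r else l)) +
      #(hookRootsAux m₂ (if a then l else r))) :
    pderiv R (axis a) (treeWeight a m α (.node u l r)) = C α * X 2 ^ k *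
      (treeWeight a m₁ α (if a then r else l) * treeWeight (!a) m₂ 1 (if a then l else r)) := by
  set s := if a then r else l with hs
  set o := if a then l else r with ho
  have hd : depth a (.node u l r) = depth a s + 1 := by cases a <;> simp [depth, hs]
  have hc := card_childVerts_node a u l r
  -- In direction `!a` the subtrees `s` and `o` exchange their roles.
  have hc' := card_childVerts_node (!a) u l r
  have hp := prefixDensity_childVerts_node a u l r
  have hp' := prefixDensity_childVerts_node (!a) u l r
  have hs' : (if (!a) = true then r else l) = o := by cases a <;> simp [ho]
  have ho' : (if (!a) = true then l else r) = s := by cases a <;> simp [hs]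
  rw [hs', ho'] at hc' hp'
  rw [← hs, ← ho] at hc hp
  have hx : ∀ (n : Fin 3 →₀ ℕ) (c : R), C α * X 2 ^ k * monomial n c =
      monomial (Finsupp.single 2 k + n) (α * c) := by
    intro n c
    rw [X_pow_eq, ← monomial_zero_eq_C_apply, monomial_mul_monomial, monomial_mul_monomial]
    simp
  have hexp : Finsupp.single (axis a) #(stepVerts a a (.node u l r)) +
      Finsupp.single (axis !a) #(childVerts (!a) (.node u l r)) +
      Finsupp.single 2 #(hookRootsAux m (.node u l r)) =
      (Finsupp.single (axis a) #(childVerts a (.node u l r)) +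
      Finsupp.single (axis !a) #(childVerts (!a) (.node u l r)) +
      Finsupp.single 2 #(hookRootsAux m (.node u l r))) + Finsupp.single (axis a) 1 := by
    rw [card_stepVerts_self_node, Finsupp.single_add]
    abel
  rw [treeWeight, treeWeight, treeWeight, monomial_mul_monomial, hx, hexp,
    pderiv_monomial_add_single, prefixDensity_stepVerts_self_node, Bool.not_not]
  have hval : (Finsupp.single (axis a) #(childVerts a (.node u l r)) +
      Finsupp.single (axis !a) #(childVerts (!a) (.node u l r)) +
      Finsupp.single 2 #(hookRootsAux m (.node u l r)) : Fin 3 →₀ ℕ) (axis a) =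
      #(childVerts a (.node u l r)) := by
    cases a <;> simp [axis]
  rw [hval]
  congr 1
  · rw [hc, hc', h]
    exact congrArg monomial (single_add_single_add_single _ _ _ _ _ _ _ _ _ _)
  · rw [hp, hp', hd]
    exact algebraMap_div_mul_pow_mul _ _ _ _ _ _ _ _

theorem card_hookRootsAux_none_node (u : Unit) (l r : BinaryTree Unit) :
    #(hookRootsAux none (.node u l r)) =
      #(hookRootsAux (some false) l) + #(hookRootsAux (some true) r) + 1 := by
  rw [hookRootsAux, card_insert_of_notMem (by simp), card_cons_union]

theorem card_hookRootsAux_some_node (a : Bool) (u : Unit) (l r : BinaryTree Unit) :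
    #(hookRootsAux (some a) (.node u l r)) = #(hookRootsAux (some a) (if a then r else l)) +
      #(hookRootsAux none (if a then l else r)) := by
  cases a
  · rw [hookRootsAux, card_cons_union]; simp
  · rw [hookRootsAux, card_cons_union]; simp [add_comm]

end BinTree

/-! ### From tree sums to the generating series of non-ambiguous trees. -/

namespace BinTree

open MvPowerSeries BinaryTree

variable {R : Type*} [CommRing R] [Algebra ℚ R]

/-- There are four kinds of hanging subtree: on the left or on the right, with a root that continues
a hook from above (`some`) or starts its own (`none`). A child leaving a branch sideways starts a
hook; below a hook root, both children continue that hook. -/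
theorem isHookSystem_treeSum :
    IsHookSystem (R := R) (fun α => treeSum (treeWeight false (some false) α))
      (fun β => treeSum (treeWeight true (some true) β)) (treeSum (treeWeight true none 1))
      (treeSum (treeWeight false none 1)) := by
  have hK (α : R) (k : ℕ) : IsHomogeneousXY 0 (C α * X 2 ^ k : MvPowerSeries (Fin 3) R) := by
    rw [X_pow_eq, ← monomial_zero_eq_C_apply, monomial_mul_monomial]
    exact isHomogeneousXY_monomial (by simp) _
  refine ⟨fun α => ?_, fun β => ?_, ?_, ?_, fun α => ?_, fun β => ?_, ?_, ?_⟩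
  · have h (l r : BinaryTree Unit) := pderiv_treeWeight_node (a := false) (m := some false)
      (m₁ := some false) (m₂ := none) (k := 0) (u := ()) (l := l) (r := r) α
      (by rw [card_hookRootsAux_some_node, zero_add])
    have := pderiv_treeSum (hK α 0) (isHomogeneousXY_treeWeight false (some false) α)
      (isHomogeneousXY_treeWeight true none 1) (.inl rfl) h
    rwa [pow_zero, mul_one] at this
  · have h (l r : BinaryTree Unit) := pderiv_treeWeight_node (a := true) (m := some true)
      (m₁ := some true) (m₂ := none) (k := 0) (u := ()) (l := l) (r := r) β
      (by rw [card_hookRootsAux_some_node, zero_add])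
    have := pderiv_treeSum (hK β 0) (isHomogeneousXY_treeWeight false none 1)
      (isHomogeneousXY_treeWeight true (some true) β) (.inr rfl)
      fun l r => (h l r).trans (congrArg _ (mul_comm _ _))
    rwa [pow_zero, mul_one] at this
  · have h (l r : BinaryTree Unit) := pderiv_treeWeight_node (a := true) (m := none)
      (m₁ := some true) (m₂ := some false) (k := 1) (u := ()) (l := l) (r := r) (1 : R)
      (by rw [card_hookRootsAux_none_node, add_comm, ← add_assoc, add_right_comm]; rfl)
    have := pderiv_treeSum (hK 1 1) (isHomogeneousXY_treeWeight false (some false) 1)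
      (isHomogeneousXY_treeWeight true (some true) 1) (.inr rfl)
      fun l r => (h l r).trans (congrArg _ (mul_comm _ _))
    rwa [map_one, pow_one, one_mul] at this
  · have h (l r : BinaryTree Unit) := pderiv_treeWeight_node (a := false) (m := none)
      (m₁ := some false) (m₂ := some true) (k := 1) (u := ()) (l := l) (r := r) (1 : R)
      (by rw [card_hookRootsAux_none_node, add_comm, ← add_assoc]; rfl)
    have := pderiv_treeSum (hK 1 1) (isHomogeneousXY_treeWeight false (some false) 1)
      (isHomogeneousXY_treeWeight true (some true) 1) (.inl rfl) h
    rwa [map_one, pow_one, one_mul] at this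
  · exact X_dvd_treeSum_sub_one (fun l r => X_dvd_treeWeight_node false _ _ () l r)
      (treeWeight_nil _ _ _)
  · exact X_dvd_treeSum_sub_one (fun l r => X_dvd_treeWeight_node true _ _ () l r)
      (treeWeight_nil _ _ _)
  · exact X_dvd_treeSum_sub_one (fun l r => X_dvd_treeWeight_node true _ _ () l r)
      (treeWeight_nil _ _ _)
  · exact X_dvd_treeSum_sub_one (fun l r => X_dvd_treeWeight_node false _ _ () l r)
      (treeWeight_nil _ _ _)

/-- The number of labellings that turn `B` into a non-ambiguous tree. -/
theorem card_shape_eq {B : BinaryTree Unit} (hB : B ≠ .nil) :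
    (Nat.card {T : NAT // T.shape = B} : ℚ) =
      (#(childVerts false B))! * (#(childVerts true B))! *
        (prefixDensity (childVerts false B) * prefixDensity (childVerts true B)) := by
  let build : ((a : Bool) → DecrLabelings (prefixRel (childVerts a B))
      (Finset.Icc 1 #(childVerts a B))) → {T : NAT // T.shape = B} := fun g =>
    ⟨⟨B, hB, fun a => (g a).1, fun a u v h h' => (g a).2 u v ⟨h, h'⟩⟩, rfl⟩
  have hbuild : Function.Bijective build := by
    constructor
    · intro g g' h
      have h' := congrArg Subtype.val h
      simp only [build, NAT.mk.injEq, heq_eq_eq, true_and] at h'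
      exact funext fun a => Subtype.ext (congrFun h' a)
    · rintro ⟨⟨_, _, label, h⟩, rfl⟩
      exact ⟨fun a => ⟨label a, fun u v huv => h a u v huv.1 huv.2⟩, rfl⟩
  have hc (a : Bool) := card_decrLabelings (prefixRel (childVerts a B))
    (A := Finset.Icc 1 #(childVerts a B)) (by simp)
  rw [← Nat.card_congr (Equiv.ofBijective build hbuild), Nat.card_pi, Fintype.prod_bool,
    Nat.cast_mul, hc, hc, prefixDensity, prefixDensity]
  simp only [Nat.card_eq_fintype_card, Fintype.card_coe]
  ring

/-- The total weight of the non-ambiguous trees of a given shape. -/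
noncomputable def shapeWeight (α β : R) (B : BinaryTree Unit) : MvPowerSeries (Fin 3) R :=
  monomial (Finsupp.single 0 #(childVerts false B) + Finsupp.single 1 #(childVerts true B) +
      Finsupp.single 2 (hookNumber B))
    (algebraMap ℚ R (prefixDensity (childVerts false B) * prefixDensity (childVerts true B)) *
      (α ^ branchLength false B * β ^ branchLength true B))

/-- The root is not a child, so it contributes only its hook; both of its subtrees continue that
hook, each along its own branch. -/
theorem shapeWeight_node (α β : R) (u : Unit) (l r : BinaryTree Unit) :
    shapeWeight α β (.node u l r) =
      X 2 * (treeWeight false (some false) α l * treeWeight true (some true) β r) := by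
  have hx (n : Fin 3 →₀ ℕ) (c : R) : X 2 * monomial n c = monomial (Finsupp.single 2 1 + n) c := by
    rw [X_def, monomial_mul_monomial, one_mul]
  rw [treeWeight, treeWeight, monomial_mul_monomial, hx, shapeWeight, hookNumber, hookRoots]
  have h0 := card_childVerts_node false u l r
  have h1 := card_childVerts_node true u l r
  have h2 := prefixDensity_childVerts_node false u l r
  have h3 := prefixDensity_childVerts_node true u l r
  have h4 := branchLength_node false u l r
  have h5 := branchLength_node true u l r
  simp only [Bool.false_eq_true, if_true, if_false] at h0 h1 h2 h3 h4 h5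
  rw [h0, h1, h2, h3, h4, h5, card_hookRootsAux_none_node, add_comm _ 1, ← add_assoc]
  congr 1
  · exact congrArg monomial (single_add_single_add_single _ _ _ _ _ _ _ _ _ _)
  · simp only [map_mul, Bool.not_true, Bool.not_false]
    ring

theorem card_filter_shape_eq {i j : ℕ} {B : BinaryTree Unit} :
    (#{T ∈ NAT.ofGeometricSize i j | T.shape = B} : ℚ) =
      if B ≠ .nil ∧ #(childVerts false B) + 1 = i ∧ #(childVerts true B) + 1 = j then
        (#(childVerts false B))! * (#(childVerts true B))! *
          (prefixDensity (childVerts false B) * prefixDensity (childVerts true B))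
      else 0 := by
  have hmem (T : NAT) : T ∈ ({T ∈ NAT.ofGeometricSize i j | T.shape = B} : Finset NAT) ↔
      (#(childVerts false B) + 1 = i ∧ #(childVerts true B) + 1 = j) ∧ T.shape = B := by
    simp only [NAT.ofGeometricSize, mem_filter, Set.Finite.mem_toFinset, Set.mem_ofPred_eq]
    refine and_congr_left fun h => ?_
    subst h
    rfl
  split_ifs with h
  · rw [← card_shape_eq h.1, Nat.subtype_card _ fun T => (hmem T).trans (and_iff_right h.2)]
  · rw [Nat.cast_eq_zero, card_eq_zero, eq_empty_iff_forall_notMem]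
    intro T hT
    obtain ⟨h1, h2⟩ := (hmem T).1 hT
    exact h ⟨h2 ▸ T.shape_ne_nil, h1⟩

theorem coeff_weight (α β : R) (T : NAT) (n : Fin 3 →₀ ℕ) : coeff n (T.weight α β) =
    if n = (Finsupp.single 0 #(childVerts false T.shape) +
      Finsupp.single 1 #(childVerts true T.shape) + Finsupp.single 2 (hookNumber T.shape)) then
    algebraMap ℚ R (1 / ((#(childVerts false T.shape))! * (#(childVerts true T.shape))!)) *
      (α ^ branchLength false T.shape * β ^ branchLength true T.shape) else 0 := by
  classical
  rw [NAT.weight, coeff_monomial]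
  rfl

theorem coeff_genSeries (α β : R) (n : Fin 3 →₀ ℕ) :
    coeff n (NAT.genSeries α β) =
      ∑ T ∈ NAT.ofGeometricSize (n 0 + 1) (n 1 + 1), coeff n (T.weight α β) := by
  refine finsum_eq_sum_of_support_subset _ fun T hT => ?_
  rw [Function.mem_support, coeff_weight] at hT
  have := (ite_ne_right_iff.1 hT).1
  simp [NAT.ofGeometricSize, NAT.wL, NAT.wR, this]

/-- Group the trees by shape: the number of labellings divided by the two factorials is the density
in `shapeWeight`. -/
theorem genSeries_eq (α β : R) :
    NAT.genSeries α β = X 2 * (treeSum (treeWeight false (some false) α) *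
      treeSum (treeWeight true (some true) β)) := by
  classical
  have hK : IsHomogeneousXY 0 (X 2 : MvPowerSeries (Fin 3) R) :=
    isHomogeneousXY_monomial (by simp) _
  ext n
  rw [← sum_coeff_node (F := shapeWeight α β) hK (isHomogeneousXY_treeWeight _ _ _)
    (isHomogeneousXY_treeWeight _ _ _) (fun l r => shapeWeight_node α β () l r), coeff_genSeries]
  rw [← sum_fiberwise_of_maps_to (g := NAT.shape) (t := treesOfNumNodesEq (n 0 + n 1 + 1))]
  · refine sum_congr rfl fun B hB => ?_
    have hB' : B ≠ .nil := by
      rintro rfl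
      simp at hB
    have hT : ∀ T ∈ ({T ∈ NAT.ofGeometricSize (n 0 + 1) (n 1 + 1) | T.shape = B} : Finset NAT),
        coeff n (T.weight α β) = if n = (Finsupp.single 0 #(childVerts false B) +
            Finsupp.single 1 #(childVerts true B) + Finsupp.single 2 (hookNumber B)) then
          algebraMap ℚ R (1 / ((#(childVerts false B))! * (#(childVerts true B))!)) *
            (α ^ branchLength false B * β ^ branchLength true B) else 0 := by
      intro T hT
      rw [coeff_weight, (mem_filter.1 hT).2]
    rw [sum_congr rfl hT, sum_const, nsmul_eq_mul, ← map_natCast (algebraMap ℚ R),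
      card_filter_shape_eq, shapeWeight, coeff_monomial]
    split_ifs with h1 h2 h2
    · rw [← mul_assoc, ← map_mul]
      congr 2
      have := Nat.factorial_ne_zero (#(childVerts false B))
      have := Nat.factorial_ne_zero (#(childVerts true B))
      field_simp
    · simp
    · exact absurd ⟨hB', by simp [h2], by simp [h2]⟩ h1
    · simp
  · intro T hT
    simp only [NAT.ofGeometricSize, Set.Finite.mem_toFinset, Set.mem_ofPred_eq, NAT.wL, NAT.wR] at hT
    rw [mem_treesOfNumNodesEq, ← card_childVerts T.shape T.shape_ne_nil]
    omega

theorem genSeries_eq_closedForm (α β : R) :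
    NAT.genSeries α β =
      X 2 * (hookBranchSeries 0 1 2 α * hookBranchSeries 1 0 2 β) := by
  obtain ⟨hP, hQ, -, -⟩ := isHookSystem_treeSum.unique (isHookSystem_closedForm (R := R))
  rw [genSeries_eq, ← hP, ← hQ]

end BinTree

/-! ### Partitions of a set with one element added. -/

namespace Finpartition

variable {ι : Type*} [DecidableEq ι] {s : Finset ι} {a b : ι}

theorem mem_insert_empty_unique (Q : Finpartition s) {t u : Finset ι} {x : ι}
    (ht : t ∈ insert ∅ Q.parts) (hu : u ∈ insert ∅ Q.parts) (hxt : x ∈ t) (hxu : x ∈ u) :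
    t = u := by
  rcases mem_insert.1 ht with rfl | ht
  · simp at hxt
  rcases mem_insert.1 hu with rfl | hu
  · simp at hxu
  exact Q.eq_of_mem_parts ht hu hxt hxu

theorem subset_of_mem_insert_empty (Q : Finpartition s) {t : Finset ι}
    (ht : t ∈ insert ∅ Q.parts) : t ⊆ s := by
  rcases mem_insert.1 ht with rfl | ht
  · exact empty_subset _
  · exact Q.subset ht

/-- Add a new element to a part of a partition, or as a new singleton part if `t = ∅`. -/
def insertInto (Q : Finpartition s) (ha : a ∉ s) (t : Finset ι) (ht : t ∈ insert ∅ Q.parts) :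
    Finpartition (insert a s) :=
  ofExistsUnique (insert (insert a t) (Q.parts.erase t))
    (by
      intro p hp
      rcases mem_insert.1 hp with rfl | hp
      · exact insert_subset_insert _ (Q.subset_of_mem_insert_empty ht)
      · exact (Q.subset (mem_of_mem_erase hp)).trans (subset_insert _ _))
    (by
      intro x hx
      by_cases hxt : x ∈ insert a t
      · refine ⟨insert a t, ⟨mem_insert_self _ _, hxt⟩, ?_⟩
        rintro u ⟨hu, hxu⟩
        rcases mem_insert.1 hu with rfl | hu
        · rfl
        · have hu' := mem_of_mem_erase hu
          rcases mem_insert.1 hxt with rfl | hxt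
          · exact absurd (Q.subset hu' hxu) ha
          · exact absurd (Q.mem_insert_empty_unique (mem_insert_of_mem hu') ht hxu hxt)
              (ne_of_mem_erase hu)
      · have hxs : x ∈ s := by
          rcases mem_insert.1 hx with rfl | hx
          · exact absurd (mem_insert_self _ _) hxt
          · exact hx
        refine ⟨Q.part x, ⟨mem_insert_of_mem (mem_erase.2 ⟨?_, Q.part_mem.2 hxs⟩),
          Q.mem_part hxs⟩, ?_⟩
        · rintro rfl
          exact hxt (mem_insert_of_mem (Q.mem_part hxs))
        · rintro u ⟨hu, hxu⟩
          rcases mem_insert.1 hu with rfl | hu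
          · exact absurd hxu hxt
          · exact (Q.part_eq_of_mem (mem_of_mem_erase hu) hxu).symm)
    (by
      intro h
      rcases mem_insert.1 h with h | h
      · exact absurd h.symm (insert_ne_empty _ _)
      · exact Q.empty_notMem_parts (mem_of_mem_erase h))

theorem parts_insertInto (Q : Finpartition s) (ha : a ∉ s) (t : Finset ι)
    (ht : t ∈ insert ∅ Q.parts) :
    (Q.insertInto ha t ht).parts = insert (insert a t) (Q.parts.erase t) := rfl

theorem part_insertInto_self (Q : Finpartition s) (ha : a ∉ s) (t : Finset ι)
    (ht : t ∈ insert ∅ Q.parts) : (Q.insertInto ha t ht).part a = insert a t :=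
  part_eq_of_mem _ (mem_insert_self _ _) (mem_insert_self _ _)

theorem part_insertInto (Q : Finpartition s) (ha : a ∉ s) (t : Finset ι)
    (ht : t ∈ insert ∅ Q.parts) (hb : b ∈ s) :
    (Q.insertInto ha t ht).part b = if t = Q.part b then insert a t else Q.part b := by
  split_ifs with h
  · exact part_eq_of_mem _ (mem_insert_self _ _) (mem_insert_of_mem (h ▸ Q.mem_part hb))
  · exact part_eq_of_mem _ (mem_insert_of_mem (mem_erase.2 ⟨Ne.symm h, Q.part_mem.2 hb⟩))
      (Q.mem_part hb)

theorem card_parts_insertInto (Q : Finpartition s) (ha : a ∉ s) (t : Finset ι)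
    (ht : t ∈ insert ∅ Q.parts) :
    #(Q.insertInto ha t ht).parts = #(Q.parts.erase t) + 1 := by
  rw [parts_insertInto, card_insert_of_notMem]
  intro h
  exact ha (Q.subset (mem_of_mem_erase h) (mem_insert_self _ _))

/-- A partition of `insert a s` amounts to its restriction to `s` and the rest `t` of the part of
`a`, where `t = ∅` encodes a singleton part. -/
theorem sum_insert {M : Type*} [AddCommMonoid M] (ha : a ∉ s) (F : Finpartition (insert a s) → M) :
    ∑ P, F P = ∑ Q : Finpartition s, ∑ t ∈ (insert ∅ Q.parts).attach,
      F (Q.insertInto ha t.1 t.2) := by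
  rw [sum_sigma' univ (fun Q : Finpartition s => (insert ∅ Q.parts).attach)
    fun Q t => F (Q.insertInto ha t.1 t.2)]
  symm
  refine sum_bij (fun x _ => x.1.insertInto ha x.2.1 x.2.2) (fun _ _ => mem_univ _) ?_ ?_
    fun _ _ => rfl
  · rintro ⟨Q, t, ht⟩ _ ⟨Q', t', ht'⟩ _ h
    dsimp only at h
    have hat : a ∉ t := fun h => ha (Q.subset_of_mem_insert_empty ht h)
    have hat' : a ∉ t' := fun h => ha (Q'.subset_of_mem_insert_empty ht' h)
    have hpart := congrArg (fun P => P.part a) h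
    simp only [part_insertInto_self] at hpart
    have htt : t = t' := by
      rw [← erase_insert hat, hpart, erase_insert hat']
    subst htt
    have hparts : Q.parts = Q'.parts := by
      have h1 := congrArg Finpartition.parts h
      rw [parts_insertInto, parts_insertInto] at h1
      have hn {P : Finpartition s} : insert a t ∉ P.parts.erase t := fun h =>
        ha (P.subset (mem_of_mem_erase h) (mem_insert_self _ _))
      have h2 : Q.parts.erase t = Q'.parts.erase t := by
        rw [← erase_insert (hn (P := Q)), h1, erase_insert hn]
      -- Erasing `∅` at the end treats both cases at once: `t` a genuine part, or `t = ∅`.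
      have h3 {P : Finpartition s} (ht : t ∈ insert ∅ P.parts) :
          P.parts = (insert t (P.parts.erase t)).erase ∅ := by
        rcases mem_insert.1 ht with rfl | ht
        · rw [erase_insert (notMem_erase _ _), erase_eq_of_notMem P.empty_notMem_parts]
        · rw [insert_erase ht, erase_eq_of_notMem P.empty_notMem_parts]
      rw [h3 ht, h2, ← h3 ht']
    obtain rfl := Finpartition.ext hparts
    rfl
  · intro P _
    have haP := P.mem_part (mem_insert_self a s)
    have hPa := P.part_mem.2 (mem_insert_self a s)
    set t := (P.part a).erase a with ht
    have hins : insert a t = P.part a := insert_erase haP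
    have hother {p : Finset ι} (hp : p ∈ P.parts.erase (P.part a)) : a ∉ p := fun h =>
      ne_of_mem_erase hp (P.part_eq_of_mem (mem_of_mem_erase hp) h).symm
    have hts : t ⊆ s := by
      intro x hx
      exact (mem_insert.1 (P.part_subset a (mem_of_mem_erase hx))).resolve_left (ne_of_mem_erase hx)
    -- The restriction of `P` to `s`; if `a` was a singleton, its part becomes `∅` and is discarded.
    let Q : Finpartition s := ofExistsUnique ((insert t (P.parts.erase (P.part a))).erase ∅)
      (by
        intro p hp
        rcases mem_insert.1 (mem_of_mem_erase hp) with rfl | hp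
        · exact hts
        · intro x hx
          refine (mem_insert.1 (P.subset (mem_of_mem_erase hp) hx)).resolve_left ?_
          rintro rfl
          exact hother hp hx)
      (by
        intro x hx
        have hxa : x ≠ a := by rintro rfl; exact ha hx
        have hx' := mem_insert_of_mem (a := x) (b := a) hx
        by_cases hxt : x ∈ P.part a
        · have hxt' : x ∈ t := mem_erase.2 ⟨hxa, hxt⟩
          refine ⟨t, ⟨mem_erase.2 ⟨ne_empty_of_mem hxt', mem_insert_self _ _⟩, hxt'⟩, ?_⟩
          rintro u ⟨hu, hxu⟩
          rcases mem_insert.1 (mem_of_mem_erase hu) with rfl | hu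
          · rfl
          · exact absurd (P.eq_of_mem_parts (mem_of_mem_erase hu) hPa hxu hxt) (ne_of_mem_erase hu)
        · refine ⟨P.part x, ⟨mem_erase.2 ⟨P.ne_empty (P.part_mem.2 hx'), mem_insert_of_mem
            (mem_erase.2 ⟨fun h => hxt (h ▸ P.mem_part hx'), P.part_mem.2 hx'⟩)⟩,
            P.mem_part hx'⟩, ?_⟩
          rintro u ⟨hu, hxu⟩
          rcases mem_insert.1 (mem_of_mem_erase hu) with rfl | hu
          · exact absurd (mem_of_mem_erase hxu) hxt
          · exact (P.part_eq_of_mem (mem_of_mem_erase hu) hxu).symm)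
      (notMem_erase _ _)
    have htQ : t ∈ insert ∅ Q.parts := by
      by_cases h : t = ∅
      · exact mem_insert.2 (.inl h)
      · exact mem_insert_of_mem (mem_erase.2 ⟨h, mem_insert_self _ _⟩)
    have htP : t ∉ P.parts.erase (P.part a) := by
      intro h
      obtain ⟨x, hx⟩ := P.nonempty_of_mem_parts (mem_of_mem_erase h)
      exact ne_of_mem_erase h
        (P.eq_of_mem_parts (mem_of_mem_erase h) hPa hx (mem_of_mem_erase hx))
    refine ⟨⟨Q, t, htQ⟩, mem_sigma.2 ⟨mem_univ _, mem_attach _ _⟩, Finpartition.ext ?_⟩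
    change insert (insert a t) (((insert t (P.parts.erase (P.part a))).erase ∅).erase t) = P.parts
    rw [hins, erase_right_comm, erase_insert htP,
      erase_eq_of_notMem (fun h => P.empty_notMem_parts (mem_of_mem_erase h)), insert_erase hPa]

end Finpartition

/-! ### q-Stirling numbers and their exponential generating series. -/

section QStirling

variable {R : Type*} [CommRing R]

/-- The sum over the partitions of `s` into `k` parts of `q` to the number of elements different
from `b` in the part of `b`. -/
noncomputable def markedStirling {ι : Type*} [DecidableEq ι] (q : R) (s : Finset ι) (b : ι)
    (k : ℕ) : R :=
  ∑ P : Finpartition s with #P.parts = k, q ^ #((P.part b).erase b)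

variable {ι : Type*} [DecidableEq ι]

theorem markedStirling_zero (q : R) {s : Finset ι} {b : ι} (hb : b ∈ s) :
    markedStirling q s b 0 = 0 := by
  refine sum_eq_zero fun P hP => ?_
  have := (mem_filter.1 hP).2
  rw [card_eq_zero] at this
  exact absurd (P.part_mem.2 hb) (by simp [this])

/-- The new element forms its own part, joins the part of `b` (a factor `q`), or joins one of the
`k` other parts. Keeping the mark on a fixed `b`, rather than on the largest element, is what makes
this recurrence available. -/
theorem markedStirling_insert (q : R) {s : Finset ι} {a b : ι} (ha : a ∉ s) (hb : b ∈ s) (k : ℕ) :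
    markedStirling q (insert a s) b (k + 1) =
      markedStirling q s b k + (q + k) * markedStirling q s b (k + 1) := by
  have hab : a ≠ b := by rintro rfl; exact ha hb
  have key (Q : Finpartition s) : ∑ t ∈ (insert ∅ Q.parts).attach,
      (if #(Q.insertInto ha t.1 t.2).parts = k + 1 then
        q ^ #(((Q.insertInto ha t.1 t.2).part b).erase b) else 0) =
      (if #Q.parts = k then q ^ #((Q.part b).erase b) else 0) +
        (q + k) * (if #Q.parts = k + 1 then q ^ #((Q.part b).erase b) else 0) := by
    have hQb := Q.part_mem.2 hb
    set w := q ^ #((Q.part b).erase b) with hw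
    -- Erasing `∅` removes no part, so one condition covers both a new singleton part (`k` parts
    -- before) and an enlarged part (`k + 1` parts before).
    have hterm (t : Finset ι) (ht : t ∈ insert ∅ Q.parts) :
        (if #(Q.insertInto ha t ht).parts = k + 1 then
          q ^ #(((Q.insertInto ha t ht).part b).erase b) else 0) =
        if #(Q.parts.erase t) = k then (if t = Q.part b then q * w else w) else 0 := by
      simp only [Q.card_parts_insertInto, Nat.add_right_cancel_iff, Q.part_insertInto ha t ht hb]
      congr 1
      split_ifs with h
      · rw [erase_insert_of_ne hab, card_insert_of_notMem, pow_succ', h]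
        exact fun h' => ha (Q.subset_of_mem_insert_empty ht (mem_of_mem_erase h'))
      · rfl
    rw [sum_congr rfl fun t _ => hterm t.1 t.2,
      sum_attach (insert ∅ Q.parts) fun t =>
        if #(Q.parts.erase t) = k then (if t = Q.part b then q * w else w) else 0,
      sum_insert Q.empty_notMem_parts, erase_eq_of_notMem Q.empty_notMem_parts,
      if_neg (Q.ne_empty hQb).symm]
    congr 1
    have hcard {t : Finset ι} (ht : t ∈ Q.parts) : #(Q.parts.erase t) = k ↔ #Q.parts = k + 1 := by
      rw [← card_erase_add_one ht, Nat.add_right_cancel_iff]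
    by_cases hk : #Q.parts = k + 1
    · rw [if_pos hk, ← insert_erase hQb, sum_insert (notMem_erase _ _), insert_erase hQb,
        if_pos ((hcard hQb).2 hk), if_pos rfl, sum_congr rfl (g := fun _ => w), sum_const,
        (hcard hQb).2 hk, nsmul_eq_mul]
      · ring
      · intro t ht
        rw [if_pos ((hcard (mem_of_mem_erase ht)).2 hk), if_neg (ne_of_mem_erase ht)]
    · rw [if_neg hk, mul_zero]
      exact sum_eq_zero fun t ht => if_neg fun h => hk ((hcard ht).1 h)
  simp only [markedStirling, sum_filter]
  rw [Finpartition.sum_insert ha, sum_congr rfl fun Q _ => key Q, sum_add_distrib, mul_sum]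

theorem markedStirling_singleton (q : R) (b : ι) (k : ℕ) :
    markedStirling q ({b} : Finset ι) b (k + 1) = if k = 0 then 1 else 0 := by
  have hP (P : Finpartition ({b} : Finset ι)) : P.parts = {{b}} := by
    have h (t) (ht : t ∈ P.parts) : t = {b} :=
      (subset_singleton_iff.1 (P.subset ht)).resolve_left (P.ne_empty ht)
    refine eq_singleton_iff_unique_mem.2 ⟨?_, h⟩
    have := P.part_mem.2 (mem_singleton_self b)
    rwa [h _ this] at this
  have hu : (univ : Finset (Finpartition ({b} : Finset ι))) =
      {Finpartition.indiscrete (singleton_ne_empty b)} := by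
    refine eq_singleton_iff_unique_mem.2 ⟨mem_univ _, fun P _ => Finpartition.ext ?_⟩
    rw [hP, hP]
  have hpart (P : Finpartition ({b} : Finset ι)) : P.part b = {b} :=
    P.part_eq_of_mem (by rw [hP]; simp) (mem_singleton_self b)
  rw [markedStirling, sum_filter, hu, sum_singleton, hP, hpart]
  simp

variable [Algebra ℚ R]

/-- The series `e ^ (q x) (e ^ x - 1) ^ k`. -/
noncomputable def stirlingSeries (q : R) (k : ℕ) : PowerSeries R :=
  PowerSeries.rescale q (PowerSeries.exp R) * (PowerSeries.exp R - 1) ^ k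

theorem derivative_rescale_exp (q : R) :
    PowerSeries.derivative R (PowerSeries.rescale q (PowerSeries.exp R)) =
      PowerSeries.C q * PowerSeries.rescale q (PowerSeries.exp R) := by
  ext n
  have := congrArg (PowerSeries.coeff n) (PowerSeries.derivative_exp R)
  rw [PowerSeries.coeff_derivative] at this
  rw [PowerSeries.coeff_derivative, PowerSeries.coeff_C_mul, PowerSeries.coeff_rescale,
    PowerSeries.coeff_rescale, ← this]
  ring

theorem derivative_stirlingSeries (q : R) (k : ℕ) :
    PowerSeries.derivative R (stirlingSeries q (k + 1)) =
      PowerSeries.C (q + (k + 1)) * stirlingSeries q (k + 1) +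
        PowerSeries.C (k + 1 : R) * stirlingSeries q k := by
  rw [stirlingSeries, stirlingSeries, Derivation.leibniz, Derivation.leibniz_pow,
    derivative_rescale_exp, map_sub, PowerSeries.derivative_exp, Derivation.map_one_eq_zero]
  simp only [smul_eq_mul, nsmul_eq_mul, map_add, map_one, map_natCast, add_tsub_cancel_right,
    Nat.cast_add, Nat.cast_one]
  ring

/-- Induction on the unmarked elements: the differential equation of `stirlingSeries` is the
recurrence `markedStirling_insert` multiplied by `k !`. The shift by one on both sides accounts for
`b` and its part. -/
theorem factorial_mul_markedStirling (q : R) {s : Finset ι} {b : ι} (hb : b ∉ s) (k : ℕ) :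
    (k ! : R) * markedStirling q (insert b s) b (k + 1) =
      (#s)! * PowerSeries.coeff #s (stirlingSeries q k) := by
  induction s using Finset.induction_on generalizing k with
  | empty =>
    rw [insert_empty_eq, markedStirling_singleton, card_empty]
    cases k <;> simp [stirlingSeries]
  | insert a s ha ih =>
    have hb' : b ∉ s := fun h => hb (mem_insert_of_mem h)
    have hab : a ∉ insert b s := by
      rw [mem_insert]
      rintro (rfl | h)
      · exact hb (mem_insert_self _ _)
      · exact ha h
    have hd (k : ℕ) : PowerSeries.coeff (#s + 1) (stirlingSeries q k) * (#s + 1) =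
        PowerSeries.coeff #s (PowerSeries.derivative R (stirlingSeries q k)) := by
      rw [PowerSeries.coeff_derivative]
    have hfac : ((#s + 1)! : R) = (#s + 1) * (#s)! := by
      rw [Nat.factorial_succ]; push_cast; ring
    rw [insert_comm, markedStirling_insert q hab (mem_insert_self _ _), card_insert_of_notMem ha,
      hfac]
    cases k with
    | zero =>
      rw [markedStirling_zero q (mem_insert_self _ _)]
      have h0 := ih hb' 0
      have h1 := hd 0
      rw [show stirlingSeries q 0 = PowerSeries.rescale q (PowerSeries.exp R) by
        simp [stirlingSeries], derivative_rescale_exp, PowerSeries.coeff_C_mul] at h1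
      rw [show stirlingSeries q 0 = PowerSeries.rescale q (PowerSeries.exp R) by
        simp [stirlingSeries]] at h0 ⊢
      simp only [Nat.factorial_zero, Nat.cast_one, Nat.cast_zero, one_mul] at h0 ⊢
      linear_combination q * h0 - (#s)! * h1
    | succ k =>
      have h0 := ih hb' k
      have h1 := ih hb' (k + 1)
      have h2 := hd (k + 1)
      rw [derivative_stirlingSeries, map_add, PowerSeries.coeff_C_mul, PowerSeries.coeff_C_mul]
        at h2
      have hfac' : ((k + 1)! : R) = (k + 1) * k ! := by
        rw [Nat.factorial_succ]; push_cast; ring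
      rw [hfac'] at h1 ⊢
      push_cast
      linear_combination (k + 1 : R) * h0 + (q + (k + 1)) * h1 - (#s)! * h2

theorem factorial_mul_qStirling (q : R) (n k : ℕ) :
    (k ! : R) * qStirling q (n + 1) (k + 1) =
      n ! * PowerSeries.coeff n (stirlingSeries q k) := by
  have h : insert (n + 1) (Finset.Icc 1 n) = Finset.Icc 1 (n + 1) := by
    ext; simp; omega
  have := factorial_mul_markedStirling q (s := Finset.Icc 1 n) (b := n + 1) (by simp) k
  rw [h, Nat.card_Icc, Nat.add_sub_cancel] at this
  exact this

end QStirling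

/-! ### Coefficients of the closed form. -/

section CoefficientExtraction

open MvPowerSeries

variable {R : Type*} [CommRing R]

theorem coeff_subst_X_mul_subst_X (f g : PowerSeries R) (n : Fin 3 →₀ ℕ) :
    coeff n (f.subst (X 0 : MvPowerSeries (Fin 3) R) * g.subst (X 1 : MvPowerSeries (Fin 3) R)) =
      if n 2 = 0 then PowerSeries.coeff (n 0) f * PowerSeries.coeff (n 1) g else 0 := by
  classical
  rw [coeff_mul]
  by_cases h2 : n 2 = 0
  · have hn : Finsupp.single 0 (n 0) + Finsupp.single 1 (n 1) = n := by
      ext i; fin_cases i <;> simp [h2]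
    rw [if_pos h2, sum_eq_single (Finsupp.single 0 (n 0), Finsupp.single 1 (n 1))]
    · rw [PowerSeries.coeff_subst_single, PowerSeries.coeff_subst_single]
      simp
    · intro p hp hne
      have hp := HasAntidiagonal.mem_antidiagonal.1 hp
      rw [PowerSeries.coeff_subst_single, PowerSeries.coeff_subst_single]
      by_contra hc
      have h1 := (ite_ne_right_iff.1 (left_ne_zero_of_mul hc)).1
      have h1' := (ite_ne_right_iff.1 (right_ne_zero_of_mul hc)).1
      refine hne (Prod.ext ?_ ?_)
      · rw [h1, ← hp, h1']; simp
      · rw [h1', ← hp, h1]; simp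
    · intro h
      exact absurd (HasAntidiagonal.mem_antidiagonal.2 hn) h
  · rw [if_neg h2]
    refine sum_eq_zero fun p hp => ?_
    have hp := HasAntidiagonal.mem_antidiagonal.1 hp
    rw [PowerSeries.coeff_subst_single, PowerSeries.coeff_subst_single]
    by_contra hc
    have h1 := (ite_ne_right_iff.1 (left_ne_zero_of_mul hc)).1
    have h1' := (ite_ne_right_iff.1 (right_ne_zero_of_mul hc)).1
    rw [← hp, h1, h1'] at h2
    simp at h2

theorem coeff_subst_X_mul_subst_X_mul_pow (f g : PowerSeries R) (k : ℕ) (n : Fin 3 →₀ ℕ) :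
    coeff n (f.subst (X 0 : MvPowerSeries (Fin 3) R) * g.subst (X 1 : MvPowerSeries (Fin 3) R) *
        X 2 ^ k) =
      if n 2 = k then PowerSeries.coeff (n 0) f * PowerSeries.coeff (n 1) g else 0 := by
  rw [X_pow_eq, coeff_mul_monomial, mul_one, coeff_subst_X_mul_subst_X]
  simp only [Finsupp.single_le_iff, Finsupp.tsub_apply]
  by_cases h : n 2 = k
  · simp [h]
  · simp only [Finsupp.single_eq_same, h, if_false]
    split_ifs <;> first | rfl | omega

variable [Algebra ℚ R]

theorem expVar_eq_subst_X {σ : Type*} (α : R) (i : σ) :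
    (expVar α i : MvPowerSeries σ R) =
      (PowerSeries.rescale α (PowerSeries.exp R)).subst (X i : MvPowerSeries σ R) := by
  rw [expVar, PowerSeries.rescale_eq_subst,
    PowerSeries.subst_comp_subst_apply (PowerSeries.HasSubst.smul_X' α) (PowerSeries.HasSubst.X i),
    PowerSeries.subst_smul (PowerSeries.HasSubst.X i), PowerSeries.subst_X (PowerSeries.HasSubst.X i)]

theorem expVar_mul_pow {σ : Type*} (α : R) (i : σ) (k : ℕ) :
    (expVar α i * (expVar 1 i - 1) ^ k : MvPowerSeries σ R) =
      (stirlingSeries α k).subst (X i : MvPowerSeries σ R) := by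
  have hs := PowerSeries.HasSubst.X (S := R) i
  have h1 : (1 : PowerSeries R).subst (X i : MvPowerSeries σ R) = 1 := by
    rw [← PowerSeries.coe_substAlgHom hs, map_one]
  rw [expVar_eq_subst_X, expVar_eq_subst_X, PowerSeries.rescale_one, RingHom.id_apply,
    stirlingSeries, PowerSeries.subst_mul hs, PowerSeries.subst_pow hs, PowerSeries.subst_sub hs, h1]

/-- The `k`-th power of the kernel is z^k times a series free of z, so the exponent of z selects a
single term of `B`, and there the variables x and y separate. -/
theorem coeff_expVar_mul_expVar_mul_subst (α β : R) (B : PowerSeries R) (n : Fin 3 →₀ ℕ) :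
    coeff n (expVar α 0 * expVar β 1 * B.subst (hookKernel 0 1 2 : MvPowerSeries (Fin 3) R)) =
      (-1) ^ n 2 * PowerSeries.coeff (n 2) B *
        (PowerSeries.coeff (n 0) (stirlingSeries α (n 2)) *
          PowerSeries.coeff (n 1) (stirlingSeries β (n 2))) := by
  set u : MvPowerSeries (Fin 3) R := hookKernel 0 1 2 with hu
  have hs : PowerSeries.HasSubst u :=
    .of_constantCoeff_zero (constantCoeff_hookKernel 0 1 2)
  have hpow (k : ℕ) : expVar α 0 * expVar β 1 * u ^ k = C ((-1) ^ k) *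
      ((stirlingSeries α k).subst (X 0 : MvPowerSeries (Fin 3) R) *
        (stirlingSeries β k).subst (X 1 : MvPowerSeries (Fin 3) R) * X 2 ^ k) := by
    rw [← expVar_mul_pow, ← expVar_mul_pow, hu, hookKernel, neg_pow, mul_pow, mul_pow, map_pow,
      map_neg, map_one]
    ring
  have hdvd : (PowerSeries.X : PowerSeries R) ^ (n 2 + 1) ∣
      B - (PowerSeries.trunc (n 2 + 1) B : Polynomial R) := by
    rw [PowerSeries.X_pow_dvd_iff]
    intro k hk
    simp [PowerSeries.coeff_trunc, hk]
  obtain ⟨h, hh⟩ := hdvd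
  rw [sub_eq_iff_eq_add'] at hh
  -- Cut `B` after degree `n 2`; the remainder is divisible by z^(n 2 + 1) and cannot contribute.
  have hsub : B.subst u = ∑ k ∈ range (n 2 + 1), C (PowerSeries.coeff k B) * u ^ k +
      u ^ (n 2 + 1) * h.subst u := by
    conv_lhs => rw [hh]
    rw [PowerSeries.subst_add hs, PowerSeries.subst_mul hs, PowerSeries.subst_pow hs,
      PowerSeries.subst_X hs, PowerSeries.subst_coe hs, PowerSeries.trunc_apply, map_sum]
    simp [Polynomial.aeval_monomial, Nat.Ico_zero_eq_range, MvPowerSeries.algebraMap_apply]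
  have hrem : X 2 ^ (n 2 + 1) ∣ expVar α 0 * expVar β 1 * (u ^ (n 2 + 1) * h.subst u) := by
    rw [← mul_assoc, hpow]
    exact ((dvd_mul_left _ _).mul_left _).mul_right _
  rw [hsub, mul_add, mul_sum, map_add, map_sum, sum_eq_single (n 2)]
  · rw [show expVar α 0 * expVar β 1 * (C (PowerSeries.coeff (n 2) B) * u ^ n 2) =
        C (PowerSeries.coeff (n 2) B) * (expVar α 0 * expVar β 1 * u ^ n 2) by ring, hpow,
      coeff_C_mul, coeff_C_mul, coeff_subst_X_mul_subst_X_mul_pow, if_pos rfl,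
      X_pow_dvd_iff.1 hrem n (Nat.lt_succ_self _)]
    ring
  · intro k _ hk
    rw [show expVar α 0 * expVar β 1 * (C (PowerSeries.coeff k B) * u ^ k) =
        C (PowerSeries.coeff k B) * (expVar α 0 * expVar β 1 * u ^ k) by ring, hpow,
      coeff_C_mul, coeff_C_mul, coeff_subst_X_mul_subst_X_mul_pow, if_neg (Ne.symm hk)]
    simp
  · intro hk
    simp at hk

theorem neg_one_pow_mul_coeff_binomSeries_neg (r : R) (k : ℕ) :
    (-1) ^ k * PowerSeries.coeff k (binomSeries (-r)) =
      algebraMap ℚ R (1 / k !) * (ascPochhammer R k).eval r := by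
  have h : (ascPochhammer R k).eval r = (-1) ^ k * (descPochhammer R k).eval (-r) := by
    rw [← ascPochhammer_eval_neg_eq_descPochhammer, neg_neg]
  rw [coeff_binomSeries, h]
  ring

end CoefficientExtraction

open MvPowerSeries in
-- Compute the coefficient of x^a y^b z^(k+1) twice: from the sum over trees (`hcomb`) and from the
-- closed form (`hclosed`), whose prefactor z accounts for the extra exponent. The two q-Stirling
-- numbers absorb `k !` each, against one 1/k! from the binomial series, so a single `k !` remains.
theorem NAT.sum_ofGeometricSize_eq {R : Type*} [CommRing R] [Algebra ℚ R] (α β : R) (a b k : ℕ) :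
    ∑ T ∈ NAT.ofGeometricSize (a + 1) (b + 1) with T.hookNumber = k + 1, α ^ T.lo * β ^ T.ro =
      (k ! : R) * (ascPochhammer R k).eval (α + β) * qStirling α (a + 1) (k + 1) *
        qStirling β (b + 1) (k + 1) := by
  have hcast (m : ℕ) : (m ! : R) * algebraMap ℚ R (1 / m !) = 1 := by
    rw [← map_natCast (algebraMap ℚ R), ← map_mul, ← map_one (algebraMap ℚ R)]
    congr 1
    have := Nat.factorial_ne_zero m
    field_simp
  set n : Fin 3 →₀ ℕ := Finsupp.single 0 a + Finsupp.single 1 b + Finsupp.single 2 k with hn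
  have h0 : n 0 = a := by simp [hn]
  have h1 : n 1 = b := by simp [hn]
  have h2 : n 2 = k := by simp [hn]
  have hcomb : coeff (Finsupp.single 2 1 + n) (NAT.genSeries α β) =
      algebraMap ℚ R (1 / a !) * algebraMap ℚ R (1 / b !) *
        ∑ T ∈ NAT.ofGeometricSize (a + 1) (b + 1) with T.hookNumber = k + 1,
          α ^ T.lo * β ^ T.ro := by
    rw [BinTree.coeff_genSeries, mul_sum, sum_filter]
    simp only [Finsupp.add_apply, h0, h1]
    simp only [ne_eq, Fin.reduceEq, not_false_eq_true, Finsupp.single_eq_of_ne, zero_add]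
    refine sum_congr (by simp) fun T hT => ?_
    simp only [NAT.ofGeometricSize, Set.Finite.mem_toFinset, Set.mem_ofPred_eq, NAT.wL, NAT.wR,
      Nat.add_right_cancel_iff] at hT
    rw [BinTree.coeff_weight, hT.1, hT.2]
    have hiff : Finsupp.single 2 1 + n = Finsupp.single 0 a + Finsupp.single 1 b +
        Finsupp.single 2 (BinTree.hookNumber T.shape) ↔ T.hookNumber = k + 1 := by
      constructor
      · intro h
        have := DFunLike.congr_fun h 2
        simp [h2] at this
        rw [NAT.hookNumber, ← this, add_comm]
      · intro h
        rw [NAT.hookNumber] at h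
        rw [h, hn, add_comm k 1, Finsupp.single_add]
        abel
    simp only [hiff]
    split_ifs
    · rw [← map_mul]
      congr 2
      ring
    · rfl
  have hclosed : coeff (Finsupp.single 2 1 + n) (NAT.genSeries α β) =
      algebraMap ℚ R (1 / k !) * (ascPochhammer R k).eval (α + β) *
        (PowerSeries.coeff a (stirlingSeries α k) * PowerSeries.coeff b (stirlingSeries β k)) := by
    rw [BinTree.genSeries_eq_closedForm, X_def, coeff_add_monomial_mul, one_mul,
      ← neg_one_pow_mul_coeff_binomSeries_neg, ← h0, ← h1, ← h2,
      ← coeff_expVar_mul_expVar_mul_subst, hookBranchSeries, hookBranchSeries, neg_add,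
      binomSeries_subst_add (constantCoeff_hookKernel 0 1 2), hookKernel_comm 1 0 2]
    congr 1
    ring
  have hα := factorial_mul_qStirling α a k
  have hβ := factorial_mul_qStirling β b k
  rw [hcomb] at hclosed
  set S := ∑ T ∈ NAT.ofGeometricSize (a + 1) (b + 1) with T.hookNumber = k + 1, α ^ T.lo * β ^ T.ro
  -- Multiply `hclosed` by `a ! * b !` to clear the exponential normalisation.
  have hS : S = algebraMap ℚ R (1 / k !) * (ascPochhammer R k).eval (α + β) *
      ((a ! * PowerSeries.coeff a (stirlingSeries α k)) *
        (b ! * PowerSeries.coeff b (stirlingSeries β k))) := by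
    linear_combination (a ! : R) * b ! * hclosed -
      S * (b ! * algebraMap ℚ R (1 / b !)) * hcast a - S * hcast b
  rw [hS, ← hα, ← hβ]
  linear_combination (k ! : R) * (ascPochhammer R k).eval (α + β) * qStirling α (a + 1) (k + 1) *
        qStirling β (b + 1) (k + 1) * hcast k

theorem mainTheorem3 {R : Type*} [CommRing R] [Algebra ℚ R] (α β : R) :
    (∀ i j p : ℕ, 0 < i → 0 < j → 0 < p →
      ∑ T ∈ NAT.ofGeometricSize i j with T.hookNumber = p, α ^ T.lo * β ^ T.ro =
        ((p - 1)! : R) * (ascPochhammer R (p - 1)).eval (α + β) *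
          qStirling α i p * qStirling β j p) ∧
    NAT.genSeries α β =
      let x : MvPowerSeries (Fin 3) R := MvPowerSeries.X 0
      let y : MvPowerSeries (Fin 3) R := MvPowerSeries.X 1
      let z : MvPowerSeries (Fin 3) R := MvPowerSeries.X 2
      let e : MvPowerSeries (Fin 3) R → MvPowerSeries (Fin 3) R :=
        fun f => (PowerSeries.exp R).subst f
      z * e (α • x + β • y) *
        (binomSeries (-(α + β))).subst (-(z * (e x - 1) * (e y - 1))) := by
  refine ⟨fun i j p hi hj hp => ?_, ?_⟩
  · obtain ⟨a, rfl⟩ := Nat.exists_eq_add_of_lt hi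
    obtain ⟨b, rfl⟩ := Nat.exists_eq_add_of_lt hj
    obtain ⟨k, rfl⟩ := Nat.exists_eq_add_of_lt hp
    simpa using NAT.sum_ofGeometricSize_eq α β a b k
  · rw [BinTree.genSeries_eq_closedForm, X_mul_hookBranchSeries_mul, hookKernel, expVar, expVar,
      one_smul, one_smul]
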